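/- **Setting.** Let $\Gamma$ be a countable (discrete) abelian group and $\alpha:\Gamma\to\Gamma$ an injective homomorphism whose range has finite index $N>1$, with $\bigcap_n\alpha^n(\Gamma)=\{0\}$. Let $\widehat\Gamma$ be the dual group with Haar measure $\mu$, let $\alpha^*$ be the dual endomorphism of $\widehat\Gamma$, $[\alpha^*(\omega)](\gamma)=\omega(\alpha(\gamma))$, let $c:\widehat\Gamma\to\widehat\Gamma$ be a Borel map with $\alpha^*(c(\omega))=\omega$, and put $\tau(\omega)=c(\alpha^*(\omega))\omega^{-1}\in\ker\alpha^*$. Pointwise relations between functions on $\widehat\Gamma$ are understood almost everywhere. A *generalized multiresolution analysis* (GMRA) in a Hilbert space $\mathcal H$, relative to a unitary representation $\pi$ of $\Gamma$ and a unitary operator $\delta$ on $\mathcal H$ with $\delta^{-1}\pi_\gamma\delta=\pi_{\alpha(\gamma)}$, is a family $\{V_j\}_{j\in\mathbb Z}$ of closed subspaces with $V_j\subseteq V_{j+1}=\delta(V_j)$, $\bigcap V_j=\{0\}$, $\bigcup V_j$ dense in $\mathcal H$, and $V_0$ invariant under $\pi$. GMRAs $\{V_j\}$ (for $\mathcal H,\pi,\delta$)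 and $\{V'_j\}$ (for $\mathcal H',\pi',\delta'$) are *equivalent* if there is a unitary operator $U:\mathcal H\to\mathcal H'$ with $U(V_j)=V'_j$ for all $j$, $U\pi_\gamma=\pi'_\gamma U$ for all $\gamma$, and $U\delta=\delta'U$. A *multiplicity function* is a Borel function $m:\widehat\Gamma\to\{0,1,2,\dots\}$ with $m(\omega)\le\sum_{\alpha^*(\zeta)=\omega}m(\zeta)$. Put $\widetilde m(\omega)=\sum_{\alpha^*(\zeta)=\omega}m(\zeta)-m(\omega)$, $\sigma_i=\{m\ge i\}$ and $\widetilde\sigma_k=\{\widetilde m\ge k\}$ for $i,k\ge1$. A *filter* relative to $m$ is a matrix $H=[h_{i,j}]_{i,j\ge1}$ of Borel complex-valued functions on $\widehat\Gamma$, with $h_{i,j}$ supported in $\sigma_j$ and $\sum_{\alpha^*(\zeta)=\omega}\sum_jh_{i,j}(\zeta)\overline{h_{i',j}(\zeta)}=N\delta_{i,i'}\chi_{\sigma_i}(\omega)$. A *complementary filter* to $H$ is a matrix $G=[g_{k,j}]_{k,j\ge1}$ of Borel functions, with $g_{k,j}$ supported in $\sigma_j$, $\sum_{\alpha^*(\zeta)=\omega}\sum_jg_{k,j}(\zeta)\overline{g_{k',j}(\zeta)}=N\delta_{k,k'}\chi_{\widetilde\sigma_k}(\omega)$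 and $\sum_{\alpha^*(\zeta)=\omega}\sum_jg_{k,j}(\zeta)\overline{h_{i,j}(\zeta)}=0$. They define the operators $[S_Hf](\omega)=H^t(\omega)f(\alpha^*(\omega))$ on $\mathcal V_0=\bigoplus_iL^2(\sigma_i)$ and $[S_Gf](\omega)=G^t(\omega)f(\alpha^*(\omega))$ from $\mathcal W_0=\bigoplus_kL^2(\widetilde\sigma_k)$ to $\mathcal V_0$. Both are isometries; an isometry $S$ is *pure* if the ranges of the powers $S^n$ have intersection $\{0\}$. For a direct sum $\mathcal K=\bigoplus_iL^2(\widehat\Gamma,\nu_i)$ put $D(\mathcal K)=\bigoplus_{i,\zeta}L^2(\widehat\Gamma,\nu'_{i,\zeta})$, where $\zeta$ runs over $\ker\alpha^*$ and $\nu'_{i,\zeta}=N\alpha^*_*(\nu_i|_{\{\tau=\zeta\}})$, and let $D:\mathcal K\to D(\mathcal K)$ be the unitary operator $[Df]_{i,\zeta}(\omega)=N^{-1/2}f_i(\zeta^{-1}c(\omega))$. Let $m$ be a multiplicity function, $H$ a filter relative to $m$ for which $S_H$ is pure, and $G$ a complementary filter to $H$. Put $\mathcal W_n=D(\mathcal W_{n-1})$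 for $n\ge1$ and $\mathcal H=\mathcal V_0\oplus\bigoplus_{n\ge0}\mathcal W_n$, let $[\pi_\gamma f](\omega)=\omega(\gamma)f(\omega)$ on $\mathcal H$, and let $T$ be the unitary operator on $\mathcal H$ with $[Tf]_{\mathcal V_0}=S_Hf_{\mathcal V_0}+S_Gf_{\mathcal W_0}$ and $[Tf]_{\mathcal W_n}=D^{-1}f_{\mathcal W_{n+1}}$. The *canonical GMRA* $\{V_j^{m,H,G}\}$ consists of the subspaces $V_j=T^{-j}(\mathcal V_0)$ of $\mathcal H$, relative to $\pi$ and $\delta=T^{-1}$. **Theorem.** Let $\{V_j^{m,H,G}\}$ and $\{V_j^{m',H',G'}\}$ be canonical GMRAs, for parameters $(m,H,G)$ and $(m',H',G')$ as above and the same $\Gamma,\alpha,c$. They are equivalent if and only if $m=m'$ almost everywhere and there is a matrix $A=[a_{i,j}]_{i,j\ge1}$ of Borel complex-valued functions on $\widehat\Gamma$ such that 1. $A(\omega)=\begin{pmatrix}A_1(\omega)&0\\0&0\end{pmatrix}$, where $A_1(\omega)$ is a unitary matrix of dimension $m(\omega)$, for every $\omega$; 2. $H(\omega)A^t(\omega)=A^t(\alpha^*(\omega))H'(\omega)$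 for almost every $\omega$. -/

import Mathlib

open MeasureTheory Set Filter
open scoped ENNReal ComplexConjugate

noncomputable section

universe u v w

set_option linter.unusedSectionVars false

instance PontryaginDual.instMeasurableSpace (Γ : Type u) [Monoid Γ] [TopologicalSpace Γ] :
    MeasurableSpace (PontryaginDual Γ) := borel _

instance PontryaginDual.instBorelSpace (Γ : Type u) [Monoid Γ] [TopologicalSpace Γ] :
    BorelSpace (PontryaginDual Γ) := ⟨rfl⟩

instance PontryaginDual.instSecondCountable (Γ : Type u) [Monoid Γ] [TopologicalSpace Γ]
    [DiscreteTopology Γ] [Countable Γ] : SecondCountableTopology (PontryaginDual Γ) :=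
  (ContinuousMonoidHom.isInducing_toContinuousMap Γ Circle).secondCountableTopology

/-- The standing data: a countable abelian group `Γ` (written multiplicatively, with the discrete
topology), an injective endomorphism `α` whose range has finite index `N > 1` and whose iterates
have ranges with trivial intersection, and a Borel cross-section `c` of the dual endomorphism
`α*` of the dual group. -/
structure DilationData (Γ : Type u) [CommGroup Γ] [TopologicalSpace Γ] [DiscreteTopology Γ] where
  α : Γ →* Γ
  injective : Function.Injective α
  -- `Subgroup.index` is `0` for a subgroup of infinite index
  one_lt_index : 1 < α.range.index
  iInter_range : ⋂ n : ℕ, Set.range (α^[n]) = {1}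
  c : PontryaginDual Γ → PontryaginDual Γ
  measurable_c : Measurable c
  c_section : ∀ ω,
    PontryaginDual.map (⟨α, continuous_of_discreteTopology⟩ : Γ →ₜ* Γ) (c ω) = ω

/-- Normalized Haar measure on the compact dual group. -/
def haarDual (Γ : Type u) [CommGroup Γ] [TopologicalSpace Γ] [DiscreteTopology Γ] :
    Measure (PontryaginDual Γ) :=
  Measure.haarMeasure ⊤

namespace DilationData

variable {Γ : Type u} [CommGroup Γ] [TopologicalSpace Γ] [DiscreteTopology Γ]

/-- The index `N = [Γ : α(Γ)]`. -/
def N (S : DilationData Γ) : ℕ := S.α.range.index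

/-- The dual endomorphism, `(α* ω)(γ) = ω (α γ)`. -/
def dual (S : DilationData Γ) : PontryaginDual Γ →ₜ* PontryaginDual Γ :=
  PontryaginDual.map ⟨S.α, continuous_of_discreteTopology⟩

/-- The kernel of `α*`. -/
abbrev K (S : DilationData Γ) : Subgroup (PontryaginDual Γ) := S.dual.toMonoidHom.ker

theorem dual_apply (S : DilationData Γ) (ω : PontryaginDual Γ) (γ : Γ) :
    S.dual ω γ = ω (S.α γ) := rfl

theorem dual_c (S : DilationData Γ) (ω : PontryaginDual Γ) : S.dual (S.c ω) = ω := S.c_section ω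

theorem dual_coe_K (S : DilationData Γ) (ζ : S.K) : S.dual (ζ : PontryaginDual Γ) = 1 := ζ.2

/-- `τ(ω) = c(α* ω) ω⁻¹`, an element of the kernel of `α*`. -/
def τ (S : DilationData Γ) (ω : PontryaginDual Γ) : S.K :=
  ⟨S.c (S.dual ω) * ω⁻¹, by
    change S.dual (S.c (S.dual ω) * ω⁻¹) = 1
    rw [map_mul, map_inv, dual_c, mul_inv_cancel]⟩

theorem card_K (S : DilationData Γ) : Nat.card S.K = S.N := by
  have hN : S.α.range.index ≠ 0 := by have := S.one_lt_index; omega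
  have : S.α.range.FiniteIndex := ⟨hN⟩
  have : Finite (Γ ⧸ S.α.range) := inferInstance
  have h1 : Nat.card ((Γ ⧸ S.α.range) →* ℂˣ) = Nat.card (Γ ⧸ S.α.range) :=
    CommGroup.card_monoidHom_of_hasEnoughRootsOfUnity _ _
  have hfin : ∀ (f : (Γ ⧸ S.α.range) →* ℂˣ) x, ‖((f x : ℂˣ) : ℂ)‖ = 1 := by
    intro f x
    have hx : (f x) ^ Nat.card (Γ ⧸ S.α.range) = 1 := by
      rw [← map_pow, pow_card_eq_one', map_one]
    have : ((f x : ℂˣ) : ℂ) ^ Nat.card (Γ ⧸ S.α.range) = 1 := by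
      rw [← Units.val_pow_eq_pow_val, hx]; rfl
    exact Complex.norm_eq_one_of_pow_eq_one this Nat.card_pos.ne'
  let e : ((Γ ⧸ S.α.range) →* ℂˣ) ≃ S.K :=
    { toFun := fun f =>
        ⟨(⟨{ toFun := fun γ => ⟨(f (QuotientGroup.mk γ) : ℂˣ), mem_sphere_zero_iff_norm.2 (hfin f _)⟩
             map_one' := by ext; simp
             map_mul' := fun a b => by ext; simp; rfl },
            continuous_of_discreteTopology⟩ : Γ →ₜ* Circle), by
          change S.dual _ = 1
          ext γ
          change ((f (QuotientGroup.mk (S.α γ)) : ℂˣ) : ℂ) = 1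
          have : (QuotientGroup.mk (S.α γ) : Γ ⧸ S.α.range) = 1 :=
            (QuotientGroup.eq_one_iff _).2 ⟨γ, rfl⟩
          rw [this, map_one]; rfl⟩
      invFun := fun ζ => QuotientGroup.lift S.α.range
        (Circle.toUnits.comp ((ζ : PontryaginDual Γ) : Γ →ₜ* Circle).toMonoidHom) (by
          rintro _ ⟨γ, rfl⟩
          have h := S.dual_coe_K ζ
          have h' : S.dual (ζ : PontryaginDual Γ) γ = 1 := by rw [h]; rfl
          rw [dual_apply] at h'
          change Circle.toUnits ((ζ : PontryaginDual Γ) (S.α γ)) = 1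
          rw [h', map_one])
      left_inv := fun f => by
        ext x
        rfl
      right_inv := fun ζ => by
        apply Subtype.ext
        apply PontryaginDual.ext
        intro γ
        rfl }
  rw [← Nat.card_congr e, h1]; rfl

instance finite_K (S : DilationData Γ) : Finite S.K := by
  apply Nat.finite_of_card_ne_zero
  rw [card_K]
  have := S.one_lt_index
  unfold N
  omega

theorem N_pos (S : DilationData Γ) : 0 < S.N := by
  have := S.one_lt_index
  unfold N
  omega

/-- The fibre of `α*` over `ω` is parametrized by the kernel. -/
def fibreEquiv (S : DilationData Γ) (ω : PontryaginDual Γ) : S.K ≃ {ζ // S.dual ζ = ω} where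
  toFun κ := ⟨κ * S.c ω, by rw [map_mul, dual_coe_K, dual_c, one_mul]⟩
  invFun ζ := ⟨ζ.1 * (S.c ω)⁻¹, by
    change S.dual _ = 1
    rw [map_mul, map_inv, dual_c, ζ.2, mul_inv_cancel]⟩
  left_inv κ := by ext1; simp
  right_inv ζ := by ext1; simp

end DilationData

namespace DilationData

variable {Γ : Type u} [CommGroup Γ] [TopologicalSpace Γ] [DiscreteTopology Γ]

instance instIsHaarHaarDual : (haarDual Γ).IsHaarMeasure := by
  unfold haarDual; infer_instance

theorem dual_surjective (S : DilationData Γ) : Function.Surjective S.dual :=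
  fun ω => ⟨S.c ω, S.dual_c ω⟩

theorem measurable_dual (S : DilationData Γ) : Measurable S.dual :=
  S.dual.continuous_toFun.measurable

theorem measurePreserving_dual (S : DilationData Γ) :
    MeasurePreserving S.dual (haarDual Γ) (haarDual Γ) := by
  have : IsFiniteMeasure (haarDual Γ) := inferInstance
  exact MonoidHom.measurePreserving (f := S.dual.toMonoidHom) S.dual.continuous_toFun
    S.dual_surjective rfl

variable [Countable Γ]

theorem measurable_mul_c (S : DilationData Γ) (κ : S.K) :
    Measurable fun ω => (κ : PontryaginDual Γ) * S.c ω :=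
  measurable_const.mul S.measurable_c

theorem lintegral_fibre (S : DilationData Γ) [Fintype S.K] {f : PontryaginDual Γ → ℝ≥0∞}
    (hf : Measurable f) :
    (S.N : ℝ≥0∞) * ∫⁻ ω, f ω ∂(haarDual Γ) =
      ∫⁻ ω, ∑ κ : S.K, f (κ * S.c ω) ∂(haarDual Γ) := by
  have h1 : ∀ ω, ∑ κ : S.K, f (κ * ω) = ∑ κ : S.K, f (κ * S.c (S.dual ω)) := by
    intro ω
    refine Fintype.sum_equiv (Equiv.mulRight (S.τ ω)⁻¹) _ _ fun κ => ?_
    congr 1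
    simp [τ, mul_assoc]
  have hm : Measurable fun ω => ∑ κ : S.K, f (κ * S.c ω) :=
    Finset.measurable_sum _ fun κ _ => hf.comp (S.measurable_mul_c κ)
  rw [← S.measurePreserving_dual.lintegral_comp hm]
  simp_rw [← h1]
  have hm' : ∀ κ : S.K, Measurable fun ω => f ((κ : PontryaginDual Γ) * ω) :=
    fun κ => hf.comp (measurable_const_mul _)
  rw [lintegral_finsetSum _ fun κ _ => hm' κ]
  simp_rw [lintegral_mul_left_eq_self (μ := haarDual Γ) f]
  rw [Finset.sum_const, nsmul_eq_mul, Finset.card_univ, ← Nat.card_eq_fintype_card, card_K]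

theorem ae_fibre (S : DilationData Γ) {p : PontryaginDual Γ → Prop}
    (h : ∀ᵐ ω ∂(haarDual Γ), p ω) :
    ∀ᵐ ω ∂(haarDual Γ), ∀ κ : S.K, p (κ * S.c ω) := by
  have : Fintype S.K := Fintype.ofFinite _
  obtain ⟨t, hpt, ht, h0⟩ := exists_measurable_superset_of_null (ae_iff.1 h)
  have h2 := S.lintegral_fibre (f := t.indicator 1) (measurable_one.indicator ht)
  rw [lintegral_indicator_one ht, h0, mul_zero, eq_comm, lintegral_eq_zero_iff] at h2
  · filter_upwards [h2] with ω hω κ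
    by_contra hp
    have h3 := (Finset.sum_eq_zero_iff.1 hω) κ (Finset.mem_univ _)
    rw [indicator_of_mem (hpt hp)] at h3
    exact one_ne_zero h3
  · exact Finset.measurable_sum _ fun κ _ =>
      (measurable_one.indicator ht).comp (S.measurable_mul_c κ)

theorem measurableSet_τ (S : DilationData Γ) (ζ : S.K) : MeasurableSet {ω | S.τ ω = ζ} := by
  have : {ω | S.τ ω = ζ} = {ω | S.c (S.dual ω) * ω⁻¹ = (ζ : PontryaginDual Γ)} := by
    ext ω; simp [Subtype.ext_iff, τ]
  rw [this]
  exact measurableSet_eq_fun ((S.measurable_c.comp S.measurable_dual).mul measurable_inv)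
    measurable_const

end DilationData

/-- The Hilbert space direct sum `⨁ᵢ L²(νᵢ)`. -/
abbrev L2Sum {X : Type u} [MeasurableSpace X] {ι : Type v} (ν : ι → Measure X) : Type (max u v) :=
  lp (fun i => Lp ℂ 2 (ν i)) 2

namespace L2Sum

variable {X : Type u} [MeasurableSpace X] {ι : Type v} {ν : ι → Measure X}

theorem ext_ae {f g : L2Sum ν} (h : ∀ i, f i =ᵐ[ν i] g i) : f = g := by
  apply lp.ext
  funext i
  exact Lp.ext (h i)

theorem enorm_component (f : L2Sum ν) (i : ι) :
    ∫⁻ x, ‖f i x‖ₑ ^ 2 ∂(ν i) = ENNReal.ofReal (‖f i‖ ^ 2) := by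
  rw [Lp.norm_def, ENNReal.ofReal_pow ENNReal.toReal_nonneg,
    ENNReal.ofReal_toReal (Lp.eLpNorm_ne_top _),
    eLpNorm_eq_lintegral_rpow_enorm_toReal two_ne_zero ENNReal.ofNat_ne_top]
  simp only [ENNReal.toReal_ofNat, ENNReal.rpow_ofNat]
  rw [← ENNReal.rpow_natCast, ← ENNReal.rpow_mul]
  norm_num

theorem tsum_lintegral (f : L2Sum ν) :
    ∑' i, ∫⁻ x, ‖f i x‖ₑ ^ 2 ∂(ν i) = ENNReal.ofReal (‖f‖ ^ 2) := by
  simp_rw [enorm_component]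
  have h := lp.hasSum_norm (p := 2) (by norm_num) f
  simp only [ENNReal.toReal_ofNat, Real.rpow_ofNat] at h
  rw [← h.tsum_eq, ENNReal.ofReal_tsum_of_nonneg (fun i => by positivity) h.summable]

theorem memLp_of_tsum {F : ι → X → ℂ} (hF : ∀ i, AEStronglyMeasurable (F i) (ν i))
    (h : ∑' i, ∫⁻ x, ‖F i x‖ₑ ^ 2 ∂(ν i) ≠ ∞) (i : ι) : MemLp (F i) 2 (ν i) := by
  refine ⟨hF i, ?_⟩
  rw [eLpNorm_lt_top_iff_lintegral_rpow_enorm_lt_top two_ne_zero ENNReal.ofNat_ne_top]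
  simp only [ENNReal.toReal_ofNat, ENNReal.rpow_ofNat]
  exact (ENNReal.ne_top_of_tsum_ne_top h i).lt_top

theorem memℓp_of_tsum {F : ι → X → ℂ} (hF : ∀ i, AEStronglyMeasurable (F i) (ν i))
    (h : ∑' i, ∫⁻ x, ‖F i x‖ₑ ^ 2 ∂(ν i) ≠ ∞) :
    Memℓp (fun i => (memLp_of_tsum hF h i).toLp (F i)) 2 := by
  have h2 : ∀ i, ‖(memLp_of_tsum hF h i).toLp (F i)‖ ^ 2 =
      (∫⁻ x, ‖F i x‖ₑ ^ 2 ∂(ν i)).toReal := fun i => by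
    rw [Lp.norm_toLp, eLpNorm_eq_lintegral_rpow_enorm_toReal two_ne_zero ENNReal.ofNat_ne_top]
    simp only [ENNReal.toReal_ofNat, ENNReal.rpow_ofNat]
    rw [← ENNReal.toReal_pow, ← ENNReal.rpow_natCast, ← ENNReal.rpow_mul]
    norm_num
  refine memℓp_gen ?_
  simp only [ENNReal.toReal_ofNat, Real.rpow_ofNat, h2]
  exact ENNReal.summable_toReal h

/-- Assemble an element of `⨁ᵢ L²(νᵢ)` from a square-summable family of functions. -/
def ofFun (F : ι → X → ℂ) (hF : ∀ i, AEStronglyMeasurable (F i) (ν i))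
    (h : ∑' i, ∫⁻ x, ‖F i x‖ₑ ^ 2 ∂(ν i) ≠ ∞) : L2Sum ν :=
  ⟨fun i => (memLp_of_tsum hF h i).toLp (F i), memℓp_of_tsum hF h⟩

theorem ofFun_ae (F : ι → X → ℂ) (hF : ∀ i, AEStronglyMeasurable (F i) (ν i))
    (h : ∑' i, ∫⁻ x, ‖F i x‖ₑ ^ 2 ∂(ν i) ≠ ∞) (i : ι) : ofFun F hF h i =ᵐ[ν i] F i :=
  MemLp.coeFn_toLp (memLp_of_tsum hF h i)

theorem tsum_lintegral_congr (f : L2Sum ν) (F : ι → X → ℂ) (h : ∀ i, f i =ᵐ[ν i] F i) :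
    ∑' i, ∫⁻ x, ‖F i x‖ₑ ^ 2 ∂(ν i) = ENNReal.ofReal (‖f‖ ^ 2) := by
  rw [← tsum_lintegral]
  refine tsum_congr fun i => lintegral_congr_ae ?_
  filter_upwards [h i] with x hx
  rw [hx]

theorem add_ae (f g : L2Sum ν) (i : ι) : (f + g) i =ᵐ[ν i] fun x => f i x + g i x :=
  Lp.coeFn_add (f i) (g i)

theorem smul_ae (a : ℂ) (f : L2Sum ν) (i : ι) : (a • f) i =ᵐ[ν i] fun x => a * f i x :=
  Lp.coeFn_smul a (f i)

variable {Y : Type u} [MeasurableSpace Y] {κ : Type w} {ρ : κ → Measure Y}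

/-- A norm-preserving linear operator between direct sums of `L²` spaces, given by a formula. -/
def mkIsometry (Φ : L2Sum ν → κ → Y → ℂ)
    (hm : ∀ f k, AEStronglyMeasurable (Φ f k) (ρ k))
    (hadd : ∀ f g k, Φ (f + g) k =ᵐ[ρ k] fun y => Φ f k y + Φ g k y)
    (hsmul : ∀ (a : ℂ) f k, Φ (a • f) k =ᵐ[ρ k] fun y => a * Φ f k y)
    (hnorm : ∀ f, ∑' k, ∫⁻ y, ‖Φ f k y‖ₑ ^ 2 ∂(ρ k) = ENNReal.ofReal (‖f‖ ^ 2)) :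
    L2Sum ν →ₗᵢ[ℂ] L2Sum ρ where
  toFun f := ofFun (Φ f) (hm f) (by rw [hnorm]; exact ENNReal.ofReal_ne_top)
  map_add' f g := ext_ae fun k => by
    refine (ofFun_ae _ _ _ k).trans ((hadd f g k).trans ?_)
    refine EventuallyEq.trans ?_ (add_ae _ _ k).symm
    filter_upwards [ofFun_ae (Φ f) (hm f) (by rw [hnorm]; exact ENNReal.ofReal_ne_top) k,
      ofFun_ae (Φ g) (hm g) (by rw [hnorm]; exact ENNReal.ofReal_ne_top) k] with y h1 h2
    rw [h1, h2]
  map_smul' a f := ext_ae fun k => by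
    refine (ofFun_ae _ _ _ k).trans ((hsmul a f k).trans ?_)
    refine EventuallyEq.trans ?_ (smul_ae _ _ k).symm
    filter_upwards [ofFun_ae (Φ f) (hm f) (by rw [hnorm]; exact ENNReal.ofReal_ne_top) k]
      with y h1
    rw [RingHom.id_apply, h1]
  norm_map' f := by
    have h1 := tsum_lintegral_congr _ (Φ f)
      (ofFun_ae (Φ f) (hm f) (by rw [hnorm]; exact ENNReal.ofReal_ne_top))
    replace h1 := (hnorm f).symm.trans h1
    rw [ENNReal.ofReal_eq_ofReal_iff (by positivity) (by positivity)] at h1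
    exact ((sq_eq_sq₀ (norm_nonneg _) (norm_nonneg _)).1 h1).symm

theorem mkIsometry_ae (Φ : L2Sum ν → κ → Y → ℂ)
    (hm : ∀ f k, AEStronglyMeasurable (Φ f k) (ρ k))
    (hadd : ∀ f g k, Φ (f + g) k =ᵐ[ρ k] fun y => Φ f k y + Φ g k y)
    (hsmul : ∀ (a : ℂ) f k, Φ (a • f) k =ᵐ[ρ k] fun y => a * Φ f k y)
    (hnorm : ∀ f, ∑' k, ∫⁻ y, ‖Φ f k y‖ₑ ^ 2 ∂(ρ k) = ENNReal.ofReal (‖f‖ ^ 2))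
    (f : L2Sum ν) (k : κ) :
    mkIsometry Φ hm hadd hsmul hnorm f k =ᵐ[ρ k] Φ f k :=
  ofFun_ae (Φ f) (hm f) (by rw [hnorm]; exact ENNReal.ofReal_ne_top) k

end L2Sum

/-- A matrix with `M Mᴴ = N I` maps (by its transpose) with `‖Mᵗ x‖² = N ‖x‖²`. -/
theorem sum_norm_sq_of_rows {I J : Type*} [Fintype I] [Fintype J] [DecidableEq I]
    (M : I → J → ℂ) (N : ℕ)
    (h : ∀ i i', ∑ j, M i j * conj (M i' j) = if i = i' then (N : ℂ) else 0) (x : I → ℂ) :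
    ∑ j, ‖∑ i, M i j * x i‖ ^ 2 = N * ∑ i, ‖x i‖ ^ 2 := by
  have key : ∀ z : ℂ, ((‖z‖ ^ 2 : ℝ) : ℂ) = z * conj z := fun z => by
    rw [Complex.mul_conj, Complex.normSq_eq_norm_sq]
  apply Complex.ofReal_injective
  rw [Complex.ofReal_sum, Complex.ofReal_mul, Complex.ofReal_sum]
  simp_rw [key, map_sum, Finset.sum_mul_sum, map_mul]
  rw [Finset.sum_comm]
  simp_rw [Finset.sum_comm (s := (Finset.univ : Finset J))]
  have h2 : ∀ i i', ∑ j, M i j * x i * (conj (M i' j) * conj (x i')) =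
      (if i = i' then (N : ℂ) else 0) * (x i * conj (x i')) := fun i i' => by
    rw [← h, Finset.sum_mul]
    exact Finset.sum_congr rfl fun j _ => by ring
  simp_rw [h2]
  simp [Finset.mul_sum]

theorem expand_of_rows {I J : Type*} [Fintype I] [Fintype J] [DecidableEq I]
    (M : I → J → ℂ) (N : ℕ) (hN : N ≠ 0)
    (h : ∀ i i', ∑ j, M i j * conj (M i' j) = if i = i' then (N : ℂ) else 0)
    (hc : Fintype.card I = Fintype.card J) (y : J → ℂ) (j : J) :
    ∑ i, M i j * ((N : ℂ)⁻¹ * ∑ j', conj (M i j') * y j') = y j := by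
  classical
  have hN' : (N : ℂ) ≠ 0 := Nat.cast_ne_zero.2 hN
  let A : Matrix I J ℂ := Matrix.of M
  let B : Matrix J I ℂ := Matrix.of fun j i => (N : ℂ)⁻¹ * conj (M i j)
  have h1 : A * B = 1 := by
    ext i i'
    rw [Matrix.mul_apply, Matrix.one_apply]
    have : ∀ j, A i j * B j i' = (N : ℂ)⁻¹ * (M i j * conj (M i' j)) := fun j => by
      simp only [A, B, Matrix.of_apply]; ring
    simp_rw [this, ← Finset.mul_sum, h]
    split_ifs <;> simp [hN']
  have h2 : B * A = 1 := (Matrix.mul_eq_one_comm_of_card_eq _ _ ℂ hc).1 h1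
  have h3 : ∀ j', ∑ i, B j' i * A i j = if j' = j then 1 else 0 := fun j' => by
    rw [← Matrix.mul_apply, h2, Matrix.one_apply]
  have h4 : ∀ i, M i j * ((N : ℂ)⁻¹ * ∑ j', conj (M i j') * y j') =
      ∑ j', (B j' i * A i j) * y j' := fun i => by
    simp only [A, B, Matrix.of_apply, Finset.mul_sum]
    exact Finset.sum_congr rfl fun j' _ => by ring
  simp_rw [h4]
  rw [Finset.sum_comm]
  simp_rw [← Finset.sum_mul, h3]
  simp

namespace DilationData

variable {Γ : Type u} [CommGroup Γ] [TopologicalSpace Γ] [DiscreteTopology Γ]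

/-- The sets `σ₁ ⊇ σ₂ ⊇ …`, indexed from zero: `level m i = {ω | m ω ≥ i + 1}`. -/
def level (m : PontryaginDual Γ → ℕ) (i : ℕ) : Set (PontryaginDual Γ) := {ω | i < m ω}

/-- A system of rows `Q ω i`, indexed by any countable type, whose `i`-th row is orthogonal along
the fibres of `α*` to the others, and of squared length `N` exactly over the set `s i`. -/
structure IsRowSystem {ι : Type v} (S : DilationData Γ) (m : PontryaginDual Γ → ℕ)
    (s : ι → Set (PontryaginDual Γ)) (Q : PontryaginDual Γ → ι → ℕ → ℂ) : Prop where
  measurable_m : Measurable m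
  measurable_s : ∀ i, MeasurableSet (s i)
  finite : ∀ᵐ ω ∂(haarDual Γ), {i | ω ∈ s i}.Finite
  measurable : ∀ i j, Measurable fun ω => Q ω i j
  support : ∀ i j, ∀ᵐ ω ∂(haarDual Γ), m ω ≤ j → Q ω i j = 0
  rows : ∀ i i', ∀ᵐ ω ∂(haarDual Γ),
    (ω ∈ s i → i = i' → ∑' ζ : {ζ // S.dual ζ = ω}, ∑' j, Q ζ i j * conj (Q ζ i' j) = (S.N : ℂ)) ∧
    (¬ (ω ∈ s i ∧ i = i') → ∑' ζ : {ζ // S.dual ζ = ω}, ∑' j, Q ζ i j * conj (Q ζ i' j) = 0)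

namespace IsRowSystem

variable {ι : Type v} {S : DilationData Γ} {m : PontryaginDual Γ → ℕ}
  {s : ι → Set (PontryaginDual Γ)} {Q : PontryaginDual Γ → ι → ℕ → ℂ}

/-- The points at which all the pointwise relations hold. -/
structure Good (S : DilationData Γ) (m : PontryaginDual Γ → ℕ)
    (s : ι → Set (PontryaginDual Γ)) (Q : PontryaginDual Γ → ι → ℕ → ℂ)
    (ω : PontryaginDual Γ) : Prop where
  finite : {i | ω ∈ s i}.Finite
  support : ∀ (κ : S.K) i j, m (κ * S.c ω) ≤ j → Q (κ * S.c ω) i j = 0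
  rows : ∀ i i', (ω ∈ s i → i = i' →
      ∑ᶠ κ : S.K, ∑' j, Q (κ * S.c ω) i j * conj (Q (κ * S.c ω) i' j) = (S.N : ℂ)) ∧
    (¬ (ω ∈ s i ∧ i = i') →
      ∑ᶠ κ : S.K, ∑' j, Q (κ * S.c ω) i j * conj (Q (κ * S.c ω) i' j) = 0)

theorem tsum_fibre (S : DilationData Γ) {E : Type*} [AddCommMonoid E] [TopologicalSpace E]
    (ω : PontryaginDual Γ) (F : PontryaginDual Γ → E) :
    ∑' ζ : {ζ // S.dual ζ = ω}, F ζ = ∑ᶠ κ : S.K, F (κ * S.c ω) := by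
  have := Fintype.ofFinite S.K
  rw [← (S.fibreEquiv ω).tsum_eq fun ζ => F ζ, tsum_fintype, finsum_eq_sum_of_fintype]
  rfl

theorem ae_good [Countable Γ] [Countable ι] (h : IsRowSystem S m s Q) :
    ∀ᵐ ω ∂(haarDual Γ), Good S m s Q ω := by
  have h1 : ∀ᵐ ω ∂(haarDual Γ), ∀ κ : S.K, ∀ i j, m (κ * S.c ω) ≤ j → Q (κ * S.c ω) i j = 0 :=
    S.ae_fibre (p := fun ω => ∀ i j, m ω ≤ j → Q ω i j = 0)
      (ae_all_iff.2 fun i => ae_all_iff.2 fun j => h.support i j)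
  filter_upwards [h.finite, h1, ae_all_iff.2 fun i => ae_all_iff.2 fun i' => h.rows i i']
    with ω h2 h3 h4
  refine ⟨h2, h3, fun i i' => ?_⟩
  have h5 := h4 i i'
  rw [tsum_fibre S ω fun ζ => ∑' j, Q ζ i j * conj (Q ζ i' j)] at h5
  exact h5

variable {ω : PontryaginDual Γ}

namespace Good

theorem sum_rows (h : Good S m s Q ω) [Fintype S.K] (i i' : ι) :
    ∑ p : (Σ κ : S.K, Fin (m (κ * S.c ω))),
      Q (p.1 * S.c ω) i p.2 * conj (Q (p.1 * S.c ω) i' p.2) =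
    ∑ᶠ κ : S.K, ∑' j, Q (κ * S.c ω) i j * conj (Q (κ * S.c ω) i' j) := by
  rw [finsum_eq_sum_of_fintype, Fintype.sum_sigma]
  refine Finset.sum_congr rfl fun κ _ => ?_
  rw [tsum_eq_sum (s := Finset.range (m (κ * S.c ω))), Finset.sum_range]
  intro j hj
  rw [h.support κ i j (by simpa using hj), zero_mul]

theorem eq_zero (h : Good S m s Q ω) {i : ι} (hi : ω ∉ s i) (κ : S.K) (j : ℕ) :
    Q (κ * S.c ω) i j = 0 := by
  have := Fintype.ofFinite S.K
  by_cases hj : m (κ * S.c ω) ≤ j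
  · exact h.support κ i j hj
  have h1 := (h.sum_rows i i).trans ((h.rows i i).2 fun h2 => hi h2.1)
  simp_rw [Complex.mul_conj, Complex.normSq_eq_norm_sq] at h1
  rw [← Complex.ofReal_sum, Complex.ofReal_eq_zero,
    Finset.sum_eq_zero_iff_of_nonneg (fun _ _ => by positivity)] at h1
  simpa using h1 ⟨κ, ⟨j, not_le.1 hj⟩⟩ (Finset.mem_univ _)

theorem tsum_row (h : Good S m s Q ω) [Fintype {i // ω ∈ s i}] (x : ι → ℂ) (κ : S.K) (j : ℕ) :
    ∑' i, Q (κ * S.c ω) i j * x i = ∑ i : {i // ω ∈ s i}, Q (κ * S.c ω) i j * x i := by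
  refine Eq.trans ?_ (tsum_fintype (L := .unconditional _) _)
  refine (tsum_subtype_eq_of_support_subset (s := {i | ω ∈ s i})
    (f := fun i => Q (κ * S.c ω) i j * x i) ?_).symm
  intro i hi
  by_contra h2
  exact hi (by simp only [h.eq_zero h2, zero_mul])

theorem rows_ite (h : Good S m s Q ω) [Fintype S.K] [DecidableEq ι] (i i' : {i // ω ∈ s i}) :
    ∑ p : (Σ κ : S.K, Fin (m (κ * S.c ω))),
      Q (p.1 * S.c ω) i p.2 * conj (Q (p.1 * S.c ω) i' p.2) =
    if i = i' then (S.N : ℂ) else 0 := by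
  rw [h.sum_rows]
  split_ifs with hi
  · exact (h.rows i i').1 i.2 (congrArg _ hi)
  · exact (h.rows i i').2 fun h2 => hi (Subtype.ext h2.2)

theorem enorm_sq (h : Good S m s Q ω) [Fintype S.K] (x : ι → ℂ) :
    ∑ κ : S.K, ∑' j, (level m j).indicator
        (fun _ => ‖∑' i, Q (κ * S.c ω) i j * x i‖ₑ ^ 2) (κ * S.c ω) =
      (S.N : ℝ≥0∞) * ∑' i, (s i).indicator (fun _ => ‖x i‖ₑ ^ 2) ω := by
  classical
  have := h.finite.fintype
  have : Fintype {i // ω ∈ s i} := this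
  have e : ∀ z : ℂ, ‖z‖ₑ ^ 2 = ENNReal.ofReal (‖z‖ ^ 2) := fun z => by
    rw [ENNReal.ofReal_pow (norm_nonneg _), ofReal_norm]
  have h1 := sum_norm_sq_of_rows
    (fun (i : {i // ω ∈ s i}) (p : (Σ κ : S.K, Fin (m (κ * S.c ω)))) => Q (p.1 * S.c ω) i p.2)
    S.N h.rows_ite (fun i => x i)
  have h2 : ∑' i, (s i).indicator (fun _ => ‖x i‖ₑ ^ 2) ω =
      ∑ i : {i // ω ∈ s i}, ‖x i‖ₑ ^ 2 := by
    refine Eq.trans ?_ (tsum_fintype (L := .unconditional _) _)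
    exact (tsum_subtype {i | ω ∈ s i} fun i => ‖x i‖ₑ ^ 2).symm
  have h3 : ∀ κ : S.K, ∑' j, (level m j).indicator
        (fun _ => ‖∑' i, Q (κ * S.c ω) i j * x i‖ₑ ^ 2) (κ * S.c ω) =
      ∑ j : Fin (m (κ * S.c ω)),
        ‖∑ i : {i // ω ∈ s i}, Q (κ * S.c ω) i j * x i‖ₑ ^ 2 := fun κ => by
    rw [tsum_eq_sum (s := Finset.range (m (κ * S.c ω))), Finset.sum_range]
    · refine Finset.sum_congr rfl fun j _ => ?_
      rw [indicator_of_mem (show _ ∈ level m j from j.2), h.tsum_row]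
    · intro j hj
      exact indicator_of_notMem (fun h2 : _ ∈ level m j => hj (Finset.mem_range.2 h2)) _
  simp_rw [h3]
  rw [h2, ← Fintype.sum_sigma' (fun (κ : S.K) (j : Fin (m (κ * S.c ω))) =>
    ‖∑ i : {i // ω ∈ s i}, Q (κ * S.c ω) i j * x i‖ₑ ^ 2)]
  simp_rw [e]
  rw [← ENNReal.ofReal_sum_of_nonneg (fun _ _ => by positivity),
    ← ENNReal.ofReal_sum_of_nonneg (fun _ _ => by positivity), h1,
    ENNReal.ofReal_mul (by positivity), ENNReal.ofReal_natCast]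

theorem expand (h : Good S m s Q ω) [Fintype S.K]
    (hc : {i | ω ∈ s i}.ncard = ∑ κ : S.K, m (κ * S.c ω)) (g : ℕ → PontryaginDual Γ → ℂ)
    (κ : S.K) {j : ℕ} (hj : j < m (κ * S.c ω)) :
    ∑' i, Q (κ * S.c ω) i j * ((S.N : ℂ)⁻¹ * ∑ κ' : S.K, ∑' j',
      conj (Q (κ' * S.c ω) i j') * g j' (κ' * S.c ω)) = g j (κ * S.c ω) := by
  classical
  have := h.finite.fintype
  have : Fintype {i // ω ∈ s i} := this
  have h1 := expand_of_rows
    (fun (i : {i // ω ∈ s i}) (p : (Σ κ : S.K, Fin (m (κ * S.c ω)))) => Q (p.1 * S.c ω) i p.2)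
    S.N S.N_pos.ne' h.rows_ite
    (by
      rw [Fintype.card_sigma]
      simp only [Fintype.card_fin]
      rw [← hc, ← Nat.card_coe_set_eq, ← Nat.card_eq_fintype_card]; rfl)
    (fun p => g p.2 (p.1 * S.c ω)) ⟨κ, ⟨j, hj⟩⟩
  rw [h.tsum_row]
  refine Eq.trans (Finset.sum_congr rfl fun i _ => ?_) h1
  congr 2
  rw [Fintype.sum_sigma]
  refine Finset.sum_congr rfl fun κ' _ => ?_
  rw [tsum_eq_sum (s := Finset.range (m (κ' * S.c ω))), Finset.sum_range]
  intro j' hj'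
  rw [h.support κ' i j' (by simpa using hj'), map_zero, zero_mul]

end Good

end IsRowSystem

end DilationData

namespace DilationData

variable {Γ : Type u} [CommGroup Γ] [TopologicalSpace Γ] [DiscreteTopology Γ]

/-- `⨁ᵢ L²(sᵢ)` with respect to Haar measure on the dual group. -/
abbrev L2Sets {ι : Type v} (s : ι → Set (PontryaginDual Γ)) : Type (max u v) :=
  L2Sum fun i => (haarDual Γ).restrict (s i)

theorem measurableSet_level {m : PontryaginDual Γ → ℕ} (hm : Measurable m) (i : ℕ) :
    MeasurableSet (level m i) :=
  measurableSet_lt measurable_const hm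

/-- The function `ω ↦ Q(ω)ᵗ x(α* ω)`, in coordinates. -/
def ruelleFun {ι : Type v} (S : DilationData Γ) (Q : PontryaginDual Γ → ι → ℕ → ℂ)
    (x : ι → PontryaginDual Γ → ℂ) (j : ℕ) (ω : PontryaginDual Γ) : ℂ :=
  ∑' i, Q ω i j * x i (S.dual ω)

theorem ae_of_fibre [Countable Γ] (S : DilationData Γ) {p : PontryaginDual Γ → Prop}
    (h : ∀ᵐ ω ∂(haarDual Γ), ∀ κ : S.K, p (κ * S.c ω)) : ∀ᵐ ω ∂(haarDual Γ), p ω := by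
  filter_upwards [S.measurePreserving_dual.quasiMeasurePreserving.ae h] with ω hω
  simpa [τ] using hω (S.τ ω)⁻¹

namespace IsRowSystem

variable {ι : Type v} {S : DilationData Γ} {m : PontryaginDual Γ → ℕ}
  {s : ι → Set (PontryaginDual Γ)} {Q : PontryaginDual Γ → ι → ℕ → ℂ}
  [Countable Γ] [Countable ι]

theorem measurable_ruelleFun (h : IsRowSystem S m s Q) {x : ι → PontryaginDual Γ → ℂ}
    (hx : ∀ i, Measurable (x i)) (j : ℕ) : Measurable (ruelleFun S Q x j) :=
  Measurable.tsum fun i => (h.measurable i j).mul ((hx i).comp S.measurable_dual)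

theorem tsum_lintegral_indicator {κ : Type w} [Countable κ] {t : κ → Set (PontryaginDual Γ)}
    (ht : ∀ k, MeasurableSet (t k)) {F : κ → PontryaginDual Γ → ℝ≥0∞}
    (hF : ∀ k, Measurable (F k)) :
    ∑' k, ∫⁻ ω, F k ω ∂((haarDual Γ).restrict (t k)) =
      ∫⁻ ω, ∑' k, (t k).indicator (F k) ω ∂(haarDual Γ) := by
  rw [lintegral_tsum fun k => ((hF k).indicator (ht k)).aemeasurable]
  exact tsum_congr fun k => (lintegral_indicator (ht k) _).symm

theorem tsum_lintegral_ruelleFun (h : IsRowSystem S m s Q) {x : ι → PontryaginDual Γ → ℂ}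
    (hx : ∀ i, Measurable (x i)) :
    ∑' j, ∫⁻ ω, ‖ruelleFun S Q x j ω‖ₑ ^ 2 ∂((haarDual Γ).restrict (level m j)) =
      ∑' i, ∫⁻ ω, ‖x i ω‖ₑ ^ 2 ∂((haarDual Γ).restrict (s i)) := by
  have := Fintype.ofFinite S.K
  have hl := fun j => measurableSet_level h.measurable_m j
  have hr : ∀ j, Measurable fun ω => ‖ruelleFun S Q x j ω‖ₑ ^ 2 :=
    fun j => (h.measurable_ruelleFun hx j).enorm.pow_const 2
  rw [tsum_lintegral_indicator hl hr,
    tsum_lintegral_indicator h.measurable_s fun i => (hx i).enorm.pow_const 2]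
  have hN : (S.N : ℝ≥0∞) ≠ 0 := by exact_mod_cast S.N_pos.ne'
  rw [← ENNReal.mul_right_inj hN (ENNReal.natCast_ne_top _), S.lintegral_fibre
    (Measurable.tsum fun j => (hr j).indicator (hl j)),
    ← lintegral_const_mul _ (Measurable.tsum fun i =>
      ((hx i).enorm.pow_const 2).indicator (h.measurable_s i))]
  refine lintegral_congr_ae ?_
  filter_upwards [h.ae_good] with ω hω
  have h1 := hω.enorm_sq fun i => x i ω
  refine Eq.trans ?_ h1
  refine Finset.sum_congr rfl fun κ _ => tsum_congr fun j => ?_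
  simp only [indicator, ruelleFun, map_mul, dual_coe_K, dual_c, one_mul]

theorem ruelleFun_congr (h : IsRowSystem S m s Q) {x y : ι → PontryaginDual Γ → ℂ}
    (hxy : ∀ i, x i =ᵐ[(haarDual Γ).restrict (s i)] y i) :
    ∀ᵐ ω ∂(haarDual Γ), ∀ j, ruelleFun S Q x j ω = ruelleFun S Q y j ω := by
  refine S.ae_of_fibre ?_
  have h1 : ∀ᵐ ω ∂(haarDual Γ), ∀ i, ω ∈ s i → x i ω = y i ω :=
    ae_all_iff.2 fun i => (ae_restrict_iff' (h.measurable_s i)).1 (hxy i)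
  filter_upwards [h.ae_good, h1] with ω hω h2 κ j
  simp only [ruelleFun, map_mul, dual_coe_K, dual_c, one_mul]
  refine tsum_congr fun i => ?_
  by_cases hi : ω ∈ s i
  · rw [h2 i hi]
  · rw [hω.eq_zero hi, zero_mul, zero_mul]

theorem summable_ruelleFun (h : IsRowSystem S m s Q) (x : ι → PontryaginDual Γ → ℂ) :
    ∀ᵐ ω ∂(haarDual Γ), ∀ j, Summable fun i => Q ω i j * x i (S.dual ω) := by
  refine S.ae_of_fibre ?_
  filter_upwards [h.ae_good] with ω hω κ j
  refine summable_of_hasFiniteSupport (hω.finite.subset fun i hi => ?_)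
  by_contra h2
  exact hi (by simp only [hω.eq_zero h2, zero_mul])

theorem ruelleFun_add (h : IsRowSystem S m s Q) (x y : ι → PontryaginDual Γ → ℂ) :
    ∀ᵐ ω ∂(haarDual Γ), ∀ j, ruelleFun S Q (fun i ω => x i ω + y i ω) j ω =
      ruelleFun S Q x j ω + ruelleFun S Q y j ω := by
  filter_upwards [h.summable_ruelleFun x, h.summable_ruelleFun y] with ω h1 h2 j
  simp only [ruelleFun, mul_add]
  exact (h1 j).tsum_add (h2 j)

theorem measurable_coe (f : L2Sets s) (i : ι) : Measurable (f i) :=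
  (Lp.stronglyMeasurable (f i)).measurable

end IsRowSystem

/-- The Ruelle operator `[S_Q f](ω) = Q(ω)ᵗ f(α* ω)`. -/
def ruelle {ι : Type v} [Countable Γ] [Countable ι] {S : DilationData Γ}
    {m : PontryaginDual Γ → ℕ} {s : ι → Set (PontryaginDual Γ)}
    {Q : PontryaginDual Γ → ι → ℕ → ℂ} (h : IsRowSystem S m s Q) :
    L2Sets s →ₗᵢ[ℂ] L2Sets (level m) :=
  L2Sum.mkIsometry (fun f => ruelleFun S Q fun i => f i)
    (fun f j => (h.measurable_ruelleFun (IsRowSystem.measurable_coe f) j).aestronglyMeasurable)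
    (fun f g j => ae_restrict_of_ae (by
      filter_upwards [h.ruelleFun_congr fun i => L2Sum.add_ae f g i,
        h.ruelleFun_add (fun i => f i) fun i => g i] with ω h1 h2
      rw [h1, h2]))
    (fun a f j => ae_restrict_of_ae (by
      filter_upwards [h.ruelleFun_congr fun i => L2Sum.smul_ae a f i] with ω h1
      rw [h1, ruelleFun, ruelleFun, ← tsum_mul_left]
      exact tsum_congr fun i => by ring))
    (fun f => by
      rw [h.tsum_lintegral_ruelleFun (IsRowSystem.measurable_coe f), L2Sum.tsum_lintegral])

theorem ruelle_ae {ι : Type v} [Countable Γ] [Countable ι] {S : DilationData Γ}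
    {m : PontryaginDual Γ → ℕ} {s : ι → Set (PontryaginDual Γ)}
    {Q : PontryaginDual Γ → ι → ℕ → ℂ} (h : IsRowSystem S m s Q) (f : L2Sets s) (j : ℕ) :
    ruelle h f j =ᵐ[(haarDual Γ).restrict (level m j)] ruelleFun S Q (fun i => f i) j :=
  L2Sum.mkIsometry_ae _ _ _ _ _ f j

theorem IsRowSystem.surjective {ι : Type v} [Countable Γ] [Countable ι] {S : DilationData Γ}
    {m : PontryaginDual Γ → ℕ} {s : ι → Set (PontryaginDual Γ)}
    {Q : PontryaginDual Γ → ι → ℕ → ℂ} (h : IsRowSystem S m s Q)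
    (hc : ∀ᵐ ω ∂(haarDual Γ), {i | ω ∈ s i}.ncard = ∑' ζ : {ζ // S.dual ζ = ω}, m ζ) :
    Function.Surjective (ruelle h) := by
  have := Fintype.ofFinite S.K
  intro g
  let x : ι → PontryaginDual Γ → ℂ := fun i ω => (S.N : ℂ)⁻¹ * ∑ κ' : S.K, ∑' j',
    conj (Q (κ' * S.c ω) i j') * g j' (κ' * S.c ω)
  have hconj : Measurable (conj : ℂ → ℂ) := Complex.continuous_conj.measurable
  have hx : ∀ i, Measurable (x i) := fun i =>
    measurable_const.mul (Finset.measurable_sum _ fun κ _ => Measurable.tsum fun j =>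
      (hconj.comp ((h.measurable i j).comp (S.measurable_mul_c κ))).mul
        ((IsRowSystem.measurable_coe g j).comp (S.measurable_mul_c κ)))
  have key : ∀ᵐ ω ∂(haarDual Γ), ∀ j, ω ∈ level m j → ruelleFun S Q x j ω = g j ω := by
    refine S.ae_of_fibre ?_
    filter_upwards [h.ae_good, hc] with ω hω hc κ j hj
    rw [IsRowSystem.tsum_fibre S ω m, finsum_eq_sum_of_fintype] at hc
    have := hω.expand hc (fun j => g j) κ hj
    simpa only [ruelleFun, map_mul, dual_coe_K, dual_c, one_mul, x] using this
  have key' : ∀ j, ruelleFun S Q x j =ᵐ[(haarDual Γ).restrict (level m j)] g j := fun j =>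
    (ae_restrict_iff' (measurableSet_level h.measurable_m j)).2
      (key.mono fun ω hω => hω j)
  have hn := h.tsum_lintegral_ruelleFun hx
  rw [L2Sum.tsum_lintegral_congr g _ fun j => (key' j).symm] at hn
  let f : L2Sets s := L2Sum.ofFun x (fun i => (hx i).aestronglyMeasurable)
    (by rw [← hn]; exact ENNReal.ofReal_ne_top)
  refine ⟨f, L2Sum.ext_ae fun j => (ruelle_ae h f j).trans (EventuallyEq.trans ?_ (key' j))⟩
  refine ae_restrict_of_ae ?_
  have hf : ∀ i, f i =ᵐ[(haarDual Γ).restrict (s i)] x i := L2Sum.ofFun_ae x _ _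
  filter_upwards [h.ruelleFun_congr hf] with ω hω
  exact hω j

end DilationData

namespace DilationData

variable {Γ : Type u} [CommGroup Γ] [TopologicalSpace Γ] [DiscreteTopology Γ]

/-- For measures `νᵢ` on the dual group, the measures `ν'_{i,ζ} = N α*_*(νᵢ restricted to
`{τ = ζ}`)` of the dilated space, indexed by pairs `(i, ζ)` with `ζ` in the kernel of `α*`. -/
def dilMeasure {ι : Type v} (S : DilationData Γ) (ν : ι → Measure (PontryaginDual Γ))
    (p : ι × S.K) : Measure (PontryaginDual Γ) :=
  (S.N : ℝ≥0∞) • ((ν p.1).restrict {ω | S.τ ω = p.2}).map S.dual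

/-- The function `[D x]_{i,ζ}(ω) = N^{-1/2} xᵢ(ζ⁻¹ c(ω))`. -/
def dilFun {ι : Type v} (S : DilationData Γ) (x : ι → PontryaginDual Γ → ℂ) (p : ι × S.K)
    (ω : PontryaginDual Γ) : ℂ :=
  (Real.sqrt S.N : ℂ)⁻¹ * x p.1 ((p.2 : PontryaginDual Γ)⁻¹ * S.c ω)

section dilation

variable {ι : Type v} {S : DilationData Γ} {ν : ι → Measure (PontryaginDual Γ)} [Countable Γ]

theorem measurable_inv_mul_c (S : DilationData Γ) (ζ : S.K) :
    Measurable fun ω => (ζ : PontryaginDual Γ)⁻¹ * S.c ω :=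
  measurable_const.mul S.measurable_c

theorem map_dilMeasure (p : ι × S.K) :
    (S.dilMeasure ν p).map (fun ω => (p.2 : PontryaginDual Γ)⁻¹ * S.c ω) =
      (S.N : ℝ≥0∞) • (ν p.1).restrict {ω | S.τ ω = p.2} := by
  rw [dilMeasure, Measure.map_smul, Measure.map_map (S.measurable_inv_mul_c p.2) S.measurable_dual]
  congr 1
  conv_rhs => rw [← Measure.map_id (μ := (ν p.1).restrict {ω | S.τ ω = p.2})]
  refine Measure.map_congr ?_
  filter_upwards [ae_restrict_mem (S.measurableSet_τ p.2)] with ω hω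
  have : S.τ ω = p.2 := hω
  simp [← this, τ]

theorem quasi_dilMeasure (p : ι × S.K) :
    Measure.QuasiMeasurePreserving (fun ω => (p.2 : PontryaginDual Γ)⁻¹ * S.c ω)
      (S.dilMeasure ν p) (ν p.1) := by
  refine ⟨S.measurable_inv_mul_c p.2, ?_⟩
  rw [map_dilMeasure]
  exact (Measure.smul_absolutelyContinuous).trans Measure.restrict_le_self.absolutelyContinuous

theorem measurable_dilFun {x : ι → PontryaginDual Γ → ℂ} (hx : ∀ i, Measurable (x i))
    (p : ι × S.K) : Measurable (S.dilFun x p) :=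
  measurable_const.mul ((hx p.1).comp (S.measurable_inv_mul_c p.2))

theorem tsum_lintegral_dilFun {x : ι → PontryaginDual Γ → ℂ} (hx : ∀ i, Measurable (x i)) :
    ∑' p, ∫⁻ ω, ‖S.dilFun x p ω‖ₑ ^ 2 ∂(S.dilMeasure ν p) = ∑' i, ∫⁻ ω, ‖x i ω‖ₑ ^ 2 ∂(ν i) := by
  have hN : (S.N : ℝ≥0∞) ≠ 0 := by exact_mod_cast S.N_pos.ne'
  have hc : ‖(Real.sqrt S.N : ℂ)⁻¹‖ₑ ^ 2 = (S.N : ℝ≥0∞)⁻¹ := by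
    rw [enorm_inv, ← ENNReal.inv_pow]
    · congr 1
      rw [← ofReal_norm, Complex.norm_real, Real.norm_of_nonneg (Real.sqrt_nonneg _),
        ← ENNReal.ofReal_pow (Real.sqrt_nonneg _), Real.sq_sqrt (Nat.cast_nonneg _),
        ENNReal.ofReal_natCast]
    · have : (0 : ℝ) < S.N := by exact_mod_cast S.N_pos
      exact_mod_cast (Real.sqrt_pos.2 this).ne'
  have h1 : ∀ p : ι × S.K, ∫⁻ ω, ‖S.dilFun x p ω‖ₑ ^ 2 ∂(S.dilMeasure ν p) =
      ∫⁻ ω in {ω | S.τ ω = p.2}, ‖x p.1 ω‖ₑ ^ 2 ∂(ν p.1) := fun p => by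
    have hm : Measurable fun ω => ‖x p.1 ω‖ₑ ^ 2 := (hx p.1).enorm.pow_const 2
    simp_rw [dilFun, enorm_mul, mul_pow, hc]
    have hm' : Measurable fun ω => ‖x p.1 ((p.2 : PontryaginDual Γ)⁻¹ * S.c ω)‖ₑ ^ 2 :=
      hm.comp (S.measurable_inv_mul_c p.2)
    rw [lintegral_const_mul _ hm', ← lintegral_map hm (S.measurable_inv_mul_c p.2),
      map_dilMeasure, lintegral_smul_measure,
      smul_eq_mul, ← mul_assoc, ENNReal.inv_mul_cancel hN (ENNReal.natCast_ne_top _), one_mul]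
  simp_rw [h1]
  rw [ENNReal.tsum_prod' (f := fun p : ι × S.K =>
    ∫⁻ ω in {ω | S.τ ω = p.2}, ‖x p.1 ω‖ₑ ^ 2 ∂(ν p.1))]
  refine tsum_congr fun i => ?_
  dsimp only
  rw [← lintegral_iUnion (s := fun ζ => {ω | S.τ ω = ζ}) (fun ζ => S.measurableSet_τ ζ)]
  · rw [iUnion_eq_univ_iff.2 fun ω => ⟨S.τ ω, rfl⟩, setLIntegral_univ]
  · intro ζ ζ' hne
    exact Set.disjoint_left.2 fun ω (h1 : _ = _) (h2 : _ = _) => hne (h1.symm.trans h2)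

theorem dilFun_congr {x y : ι → PontryaginDual Γ → ℂ} (h : ∀ i, x i =ᵐ[ν i] y i) (p : ι × S.K) :
    S.dilFun x p =ᵐ[S.dilMeasure ν p] S.dilFun y p := by
  filter_upwards [(quasi_dilMeasure p).ae (h p.1)] with ω hω
  rw [dilFun, dilFun, hω]

theorem measurable_tau (S : DilationData Γ) : Measurable S.τ :=
  ((S.measurable_c.comp S.measurable_dual).mul measurable_inv).subtype_mk

/-- The dilation `D` as a norm-preserving operator. -/
def dilIsometry (S : DilationData Γ) (ν : ι → Measure (PontryaginDual Γ)) :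
    L2Sum ν →ₗᵢ[ℂ] L2Sum (S.dilMeasure ν) :=
  L2Sum.mkIsometry (fun f => S.dilFun fun i => f i)
    (fun f p => (measurable_dilFun (fun i => (Lp.stronglyMeasurable (f i)).measurable)
      p).aestronglyMeasurable)
    (fun f g p => by
      refine (dilFun_congr (fun i => L2Sum.add_ae f g i) p).trans (Eventually.of_forall fun ω => ?_)
      simp only [dilFun, mul_add])
    (fun a f p => by
      refine (dilFun_congr (fun i => L2Sum.smul_ae a f i) p).trans
        (Eventually.of_forall fun ω => ?_)
      simp only [dilFun]; ring)
    (fun f => by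
      rw [tsum_lintegral_dilFun fun i => (Lp.stronglyMeasurable (f i)).measurable,
        L2Sum.tsum_lintegral])

theorem dilIsometry_ae (f : L2Sum ν) (p : ι × S.K) :
    S.dilIsometry ν f p =ᵐ[S.dilMeasure ν p] S.dilFun (fun i => f i) p :=
  L2Sum.mkIsometry_ae _ _ _ _ _ f p

theorem dilIsometry_surjective (S : DilationData Γ) (ν : ι → Measure (PontryaginDual Γ)) :
    Function.Surjective (S.dilIsometry ν) := by
  intro g
  let x : ι → PontryaginDual Γ → ℂ := fun i ω =>
    (Real.sqrt S.N : ℂ) * g (i, S.τ ω) (S.dual ω)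
  have hx : ∀ i, Measurable (x i) := fun i => by
    have h1 : Measurable fun q : S.K × PontryaginDual Γ => g (i, q.1) q.2 :=
      measurable_from_prod_countable_right fun ζ =>
        (Lp.stronglyMeasurable (g (i, ζ))).measurable
    exact measurable_const.mul (h1.comp (S.measurable_tau.prodMk S.measurable_dual))
  have key : ∀ p ω, S.dilFun x p ω = g p ω := by
    rintro ⟨i, ζ⟩ ω
    have h0 : (Real.sqrt S.N : ℂ) ≠ 0 := by
      have : (0 : ℝ) < S.N := by exact_mod_cast S.N_pos
      exact_mod_cast (Real.sqrt_pos.2 this).ne'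
    have h1 : S.dual ((ζ : PontryaginDual Γ)⁻¹ * S.c ω) = ω := by
      rw [map_mul, map_inv, dual_coe_K, dual_c, inv_one, one_mul]
    have h2 : S.τ ((ζ : PontryaginDual Γ)⁻¹ * S.c ω) = ζ := by
      ext1
      rw [τ]
      simp only [h1]
      group
    have h3 : ∀ ζ', ζ' = ζ → g (i, ζ') ω = g (i, ζ) ω := by rintro _ rfl; rfl
    simp only [dilFun, x, h1]
    rw [h3 _ h2, ← mul_assoc, inv_mul_cancel₀ h0, one_mul]
  have hn := tsum_lintegral_dilFun (S := S) (ν := ν) hx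
  simp_rw [key] at hn
  rw [L2Sum.tsum_lintegral] at hn
  let f : L2Sum ν := L2Sum.ofFun x (fun i => (hx i).aestronglyMeasurable)
    (by rw [← hn]; exact ENNReal.ofReal_ne_top)
  have hf : ∀ i, f i =ᵐ[ν i] x i := L2Sum.ofFun_ae x _ _
  refine ⟨f, L2Sum.ext_ae fun p => (dilIsometry_ae f p).trans ((dilFun_congr hf p).trans ?_)⟩
  exact Eventually.of_forall (key p)

/-- The dilation `D`, mapping `⨁ᵢ L²(νᵢ)` isometrically onto `⨁_{i,ζ} L²(ν'_{i,ζ})`. -/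
def dilation (S : DilationData Γ) (ν : ι → Measure (PontryaginDual Γ)) :
    L2Sum ν ≃ₗᵢ[ℂ] L2Sum (S.dilMeasure ν) :=
  LinearIsometryEquiv.ofSurjective (S.dilIsometry ν) (S.dilIsometry_surjective ν)

end dilation

section translation

variable {ι : Type v} (ν : ι → Measure (PontryaginDual Γ))

theorem measurable_eval (γ : Γ) : Measurable fun ω : PontryaginDual Γ => ((ω γ : Circle) : ℂ) := by
  have h1 : Continuous fun ω : PontryaginDual Γ => ω γ := by
    exact (continuous_eval_const (F := C(Γ, Circle)) γ).comp
      (ContinuousMonoidHom.isInducing_toContinuousMap Γ Circle).continuous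
  exact (continuous_subtype_val.comp h1).measurable

/-- Multiplication by the character value, `[π_γ f](ω) = ω(γ) f(ω)`, as an isometry. -/
def charMulIsometry (γ : Γ) : L2Sum ν →ₗᵢ[ℂ] L2Sum ν :=
  L2Sum.mkIsometry (fun f i ω => ((ω γ : Circle) : ℂ) * f i ω)
    (fun f i => ((measurable_eval γ).mul
      (Lp.stronglyMeasurable (f i)).measurable).aestronglyMeasurable)
    (fun f g i => by
      filter_upwards [L2Sum.add_ae f g i] with ω hω
      rw [hω, mul_add])
    (fun a f i => by
      filter_upwards [L2Sum.smul_ae a f i] with ω hω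
      rw [hω]; ring)
    (fun f => by
      rw [← L2Sum.tsum_lintegral]
      have h1 : ∀ z : Circle, ‖(z : ℂ)‖ₑ = 1 := fun z => by
        rw [← ofReal_norm, Circle.norm_coe, ENNReal.ofReal_one]
      simp only [enorm_mul, h1, one_mul])

theorem charMulIsometry_ae (γ : Γ) (f : L2Sum ν) (i : ι) :
    charMulIsometry ν γ f i =ᵐ[ν i] fun ω => ((ω γ : Circle) : ℂ) * f i ω :=
  L2Sum.mkIsometry_ae _ _ _ _ _ f i

theorem charMulIsometry_mul (γ γ' : Γ) (f : L2Sum ν) :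
    charMulIsometry ν (γ * γ') f = charMulIsometry ν γ (charMulIsometry ν γ' f) :=
  L2Sum.ext_ae fun i => by
    filter_upwards [charMulIsometry_ae ν (γ * γ') f i, charMulIsometry_ae ν γ' f i,
      charMulIsometry_ae ν γ (charMulIsometry ν γ' f) i] with ω h1 h2 h3
    rw [h1, h3, h2, map_mul, Circle.coe_mul, mul_assoc]

theorem charMulIsometry_one (f : L2Sum ν) : charMulIsometry ν (1 : Γ) f = f :=
  L2Sum.ext_ae fun i => by
    filter_upwards [charMulIsometry_ae ν (1 : Γ) f i] with ω h1
    rw [h1, map_one, Circle.coe_one, one_mul]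

/-- The unitary representation of `Γ` on `⨁ᵢ L²(νᵢ)` by `[π_γ f](ω) = ω(γ) f(ω)`. -/
def charRep : Γ →* (L2Sum ν ≃ₗᵢ[ℂ] L2Sum ν) where
  toFun γ := LinearIsometryEquiv.ofSurjective (charMulIsometry ν γ) fun f =>
    ⟨charMulIsometry ν γ⁻¹ f, by
      rw [← charMulIsometry_mul, mul_inv_cancel, charMulIsometry_one]⟩
  map_one' := LinearIsometryEquiv.ext fun f => charMulIsometry_one ν f
  map_mul' γ γ' := LinearIsometryEquiv.ext fun f => charMulIsometry_mul ν γ γ' f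

theorem charRep_ae (γ : Γ) (f : L2Sum ν) (i : ι) :
    charRep ν γ f i =ᵐ[ν i] fun ω => ((ω γ : Circle) : ℂ) * f i ω :=
  charMulIsometry_ae ν γ f i

theorem charRep_dilation [Countable Γ] (S : DilationData Γ) (γ : Γ) (f : L2Sum ν) :
    charRep (S.dilMeasure ν) γ (S.dilation ν f) = S.dilation ν (charRep ν (S.α γ) f) :=
  L2Sum.ext_ae fun p => by
    refine EventuallyEq.trans ?_ ((dilIsometry_ae _ p).trans
      (dilFun_congr (fun i => charRep_ae ν (S.α γ) f i) p)).symm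
    filter_upwards [charRep_ae (S.dilMeasure ν) γ (S.dilation ν f) p,
      dilIsometry_ae (S := S) f p] with ω h1 h2
    rw [h1]
    change _ * (S.dilIsometry ν f) p ω = _
    rw [h2, dilFun, dilFun, ← dual_apply, map_mul, map_inv, dual_coe_K, dual_c, inv_one, one_mul]
    ring

theorem charRep_ruelle [Countable Γ] [Countable ι] {S : DilationData Γ}
    {m : PontryaginDual Γ → ℕ} {s : ι → Set (PontryaginDual Γ)}
    {Q : PontryaginDual Γ → ι → ℕ → ℂ} (h : IsRowSystem S m s Q) (γ : Γ) (f : L2Sets s) :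
    ruelle h (charRep _ γ f) = charRep _ (S.α γ) (ruelle h f) :=
  L2Sum.ext_ae fun j => by
    filter_upwards [ruelle_ae h (charRep _ γ f) j, ruelle_ae h f j,
      charRep_ae _ (S.α γ) (ruelle h f) j,
      ae_restrict_of_ae (h.ruelleFun_congr fun i => charRep_ae _ γ f i)] with ω h1 h2 h3 h4
    rw [h1, h3, h2, h4, ruelleFun, ruelleFun, ← tsum_mul_left]
    refine tsum_congr fun i => ?_
    rw [dual_apply]
    ring

end translation

end DilationData

/-- A generalized multiresolution analysis in a Hilbert space `ℋ`, relative to a unitary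
representation `π` of the (discrete) group `Γ` and a unitary dilation `δ` with
`δ⁻¹ π_γ δ = π_{α(γ)}`. -/
structure GMRA {Γ : Type u} [CommGroup Γ] (α : Γ →* Γ) (ℋ : Type v) [NormedAddCommGroup ℋ]
    [InnerProductSpace ℂ ℋ] [CompleteSpace ℋ] where
  π : Γ →* (ℋ ≃ₗᵢ[ℂ] ℋ)
  δ : ℋ ≃ₗᵢ[ℂ] ℋ
  conj_π : ∀ γ, δ⁻¹ * π γ * δ = π (α γ)
  V : ℤ → Submodule ℂ ℋ
  isClosed : ∀ j, IsClosed (V j : Set ℋ)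
  mono : ∀ j, V j ≤ V (j + 1)
  dilate : ∀ j, V (j + 1) = (V j).map δ.toLinearEquiv.toLinearMap
  iInter : ⋂ j, (V j : Set ℋ) = {0}
  dense : Dense (⋃ j, (V j : Set ℋ))
  invariant : ∀ γ, ∀ f ∈ V 0, π γ f ∈ V 0

/-- Equivalence of GMRAs. -/
def GMRA.Equivalent {Γ : Type u} [CommGroup Γ] {α : Γ →* Γ}
    {ℋ : Type v} [NormedAddCommGroup ℋ] [InnerProductSpace ℂ ℋ] [CompleteSpace ℋ]
    {ℋ' : Type w} [NormedAddCommGroup ℋ'] [InnerProductSpace ℂ ℋ'] [CompleteSpace ℋ']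
    (M : GMRA α ℋ) (M' : GMRA α ℋ') : Prop :=
  ∃ U : ℋ ≃ₗᵢ[ℂ] ℋ',
    (∀ j, (M.V j).map U.toLinearEquiv.toLinearMap = M'.V j) ∧
    (∀ γ f, U (M.π γ f) = M'.π γ (U f)) ∧
    (∀ f, U (M.δ f) = M'.δ (U f))

/-- An isometry is pure if the ranges of its powers have trivial intersection. -/
def IsPureIsometry {E : Type v} [NormedAddCommGroup E] [NormedSpace ℂ E] (S : E →ₗᵢ[ℂ] E) : Prop :=
  ⋂ n : ℕ, Set.range (S^[n]) = {0}

section lpMap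

theorem lp_norm_sq {E : ℕ → Type v} [∀ n, NormedAddCommGroup (E n)]
    (f : lp E 2) : ‖f‖ ^ 2 = ∑' n, ‖f n‖ ^ 2 := by
  have h := lp.hasSum_norm (p := 2) (by norm_num) f
  simp only [ENNReal.toReal_ofNat, Real.rpow_ofNat] at h
  exact h.tsum_eq.symm

theorem lp_summable_sq {E : ℕ → Type v} [∀ n, NormedAddCommGroup (E n)]
    (f : lp E 2) : Summable fun n => ‖f n‖ ^ 2 := by
  have h := lp.hasSum_norm (p := 2) (by norm_num) f
  simp only [ENNReal.toReal_ofNat, Real.rpow_ofNat] at h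
  exact h.summable

theorem memℓp_two {E : ℕ → Type v} [∀ n, NormedAddCommGroup (E n)]
    {f : ∀ n, E n} (h : Summable fun n => ‖f n‖ ^ 2) : Memℓp f 2 := by
  refine memℓp_gen ?_
  simpa only [ENNReal.toReal_ofNat, Real.rpow_ofNat] using h

variable {E F : ℕ → Type v} [∀ n, NormedAddCommGroup (E n)] [∀ n, InnerProductSpace ℂ (E n)]
  [∀ n, NormedAddCommGroup (F n)] [∀ n, InnerProductSpace ℂ (F n)]

/-- A direct sum of unitary operators. -/
def lpMap (A : ∀ n, E n ≃ₗᵢ[ℂ] F n) : lp E 2 ≃ₗᵢ[ℂ] lp F 2 where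
  toFun f := ⟨fun n => A n (f n), memℓp_two (by simpa using lp_summable_sq f)⟩
  invFun f := ⟨fun n => (A n).symm (f n), memℓp_two (by simpa using lp_summable_sq f)⟩
  map_add' f g := by ext n; exact map_add (A n) _ _
  map_smul' a f := by ext n; simp
  left_inv f := by ext n; simp
  right_inv f := by ext n; simp
  norm_map' f := by
    rw [← sq_eq_sq₀ (norm_nonneg _) (norm_nonneg _), lp_norm_sq, lp_norm_sq]
    simp

end lpMap

section abstractGMRA

variable {V : Type u} {W : ℕ → Type v} [NormedAddCommGroup V] [InnerProductSpace ℂ V]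
  [∀ n, NormedAddCommGroup (W n)] [∀ n, InnerProductSpace ℂ (W n)]

/-- The Hilbert space `V ⊕ ⨁ₙ Wₙ`. -/
abbrev CoreSum (V : Type u) (W : ℕ → Type v) [NormedAddCommGroup V] [InnerProductSpace ℂ V]
    [∀ n, NormedAddCommGroup (W n)] [∀ n, InnerProductSpace ℂ (W n)] : Type (max u v) :=
  WithLp 2 (V × lp W 2)

theorem coreSum_ext {f g : CoreSum V W} (h1 : f.fst = g.fst) (h2 : f.snd = g.snd) : f = g :=
  WithLp.ofLp_injective 2 (Prod.ext h1 h2)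

/-- The data for the inverse dilation on `V ⊕ ⨁ₙ Wₙ`: isometries `A : V → V` and `B : W₀ → V`
with orthogonal ranges that span `V`. -/
structure IsCuntzPair {W₀ : Type v} [NormedAddCommGroup W₀] [InnerProductSpace ℂ W₀]
    (A : V →ₗᵢ[ℂ] V) (B : W₀ →ₗᵢ[ℂ] V) : Prop where
  norm_sq : ∀ v w, ‖A v + B w‖ ^ 2 = ‖v‖ ^ 2 + ‖w‖ ^ 2
  surj : ∀ u, ∃ v w, A v + B w = u

theorem shift_summable (D : ∀ n, W n ≃ₗᵢ[ℂ] W (n + 1)) (f : lp W 2) :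
    Summable fun n => ‖(D n).symm (f (n + 1))‖ ^ 2 := by
  simpa using (summable_nat_add_iff 1).2 (lp_summable_sq f)

/-- The sequence `(D⁻¹ f₁, D⁻¹ f₂, …)`. -/
def shiftSeq (D : ∀ n, W n ≃ₗᵢ[ℂ] W (n + 1)) (f : lp W 2) : lp W 2 :=
  ⟨fun n => (D n).symm (f (n + 1)), memℓp_two (shift_summable D f)⟩

theorem shiftSeq_apply (D : ∀ n, W n ≃ₗᵢ[ℂ] W (n + 1)) (f : lp W 2) (n : ℕ) :
    shiftSeq D f n = (D n).symm (f (n + 1)) := rfl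

/-- The operator `f ↦ (A f_V + B f_{W₀}, D⁻¹ f_{W₁}, D⁻¹ f_{W₂}, …)` as an isometry. -/
def invDilationIsometry {A : V →ₗᵢ[ℂ] V} {B : W 0 →ₗᵢ[ℂ] V} (h : IsCuntzPair A B)
    (D : ∀ n, W n ≃ₗᵢ[ℂ] W (n + 1)) : CoreSum V W →ₗᵢ[ℂ] CoreSum V W where
  toFun f := WithLp.toLp 2 (A f.fst + B (f.snd 0), shiftSeq D f.snd)
  map_add' f g := by
    refine coreSum_ext ?_ ?_
    · change A (f.fst + g.fst) + B (f.snd 0 + g.snd 0) =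
        A f.fst + B (f.snd 0) + (A g.fst + B (g.snd 0))
      rw [map_add, map_add]
      abel
    · ext n
      exact map_add (D n).symm _ _
  map_smul' a f := by
    refine coreSum_ext ?_ ?_
    · change A (a • f.fst) + B (a • f.snd 0) = a • (A f.fst + B (f.snd 0))
      rw [map_smul, map_smul, smul_add]
    · ext n
      exact map_smul (D n).symm _ _
  norm_map' f := by
    rw [← sq_eq_sq₀ (norm_nonneg _) (norm_nonneg _), WithLp.prod_norm_sq_eq_of_L2,
      WithLp.prod_norm_sq_eq_of_L2, lp_norm_sq f.snd, (lp_summable_sq f.snd).tsum_eq_zero_add]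
    change ‖A f.fst + B (f.snd 0)‖ ^ 2 + ‖shiftSeq D f.snd‖ ^ 2 = _
    rw [h.norm_sq, add_assoc, lp_norm_sq]
    simp only [shiftSeq_apply, LinearIsometryEquiv.norm_map]

theorem exists_shiftSeq_eq (D : ∀ n, W n ≃ₗᵢ[ℂ] W (n + 1)) (w : W 0) (g : lp W 2) :
    ∃ f : lp W 2, f 0 = w ∧ shiftSeq D f = g := by
  let F : ∀ n, W n := fun n => Nat.casesOn n w fun k => D k (g k)
  have hF : Summable fun n => ‖F n‖ ^ 2 := by
    refine (summable_nat_add_iff 1).1 ?_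
    change Summable fun n => ‖D n (g n)‖ ^ 2
    simpa only [LinearIsometryEquiv.norm_map] using lp_summable_sq g
  refine ⟨⟨F, memℓp_two hF⟩, rfl, ?_⟩
  ext n
  exact (D n).symm_apply_apply (g n)

theorem invDilationIsometry_surjective {A : V →ₗᵢ[ℂ] V} {B : W 0 →ₗᵢ[ℂ] V}
    (h : IsCuntzPair A B) (D : ∀ n, W n ≃ₗᵢ[ℂ] W (n + 1)) :
    Function.Surjective (invDilationIsometry h D) := by
  intro g
  obtain ⟨v, w, hvw⟩ := h.surj g.fst
  obtain ⟨f, hf, hfg⟩ := exists_shiftSeq_eq D w g.snd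
  refine ⟨WithLp.toLp 2 (v, f), coreSum_ext ?_ hfg⟩
  change A v + B (f 0) = g.fst
  rw [hf, hvw]

/-- The operator `f ↦ (A f_V + B f_{W₀}, D⁻¹ f_{W₁}, D⁻¹ f_{W₂}, …)` on `V ⊕ ⨁ₙ Wₙ`. -/
def invDilation {A : V →ₗᵢ[ℂ] V} {B : W 0 →ₗᵢ[ℂ] V} (h : IsCuntzPair A B)
    (D : ∀ n, W n ≃ₗᵢ[ℂ] W (n + 1)) : CoreSum V W ≃ₗᵢ[ℂ] CoreSum V W :=
  LinearIsometryEquiv.ofSurjective (invDilationIsometry h D) (invDilationIsometry_surjective h D)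

theorem invDilation_fst {A : V →ₗᵢ[ℂ] V} {B : W 0 →ₗᵢ[ℂ] V} (h : IsCuntzPair A B)
    (D : ∀ n, W n ≃ₗᵢ[ℂ] W (n + 1)) (f : CoreSum V W) :
    (invDilation h D f).fst = A f.fst + B (f.snd 0) := rfl

theorem invDilation_snd {A : V →ₗᵢ[ℂ] V} {B : W 0 →ₗᵢ[ℂ] V} (h : IsCuntzPair A B)
    (D : ∀ n, W n ≃ₗᵢ[ℂ] W (n + 1)) (f : CoreSum V W) (n : ℕ) :
    (invDilation h D f).snd n = (D n).symm (f.snd (n + 1)) := rfl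

/-- The representation `(ρ_V, ρ_{W₀}, ρ_{W₁}, …)` on `V ⊕ ⨁ₙ Wₙ`. -/
def sumRep {Γ : Type w} [CommGroup Γ] (ρ : Γ →* (V ≃ₗᵢ[ℂ] V)) (σ : ∀ n, Γ →* (W n ≃ₗᵢ[ℂ] W n)) :
    Γ →* (CoreSum V W ≃ₗᵢ[ℂ] CoreSum V W) where
  toFun γ :=
    { toFun := fun f => WithLp.toLp 2 (ρ γ f.fst, lpMap (fun n => σ n γ) f.snd)
      invFun := fun f => WithLp.toLp 2 ((ρ γ).symm f.fst, (lpMap fun n => σ n γ).symm f.snd)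
      map_add' := fun f g => by refine coreSum_ext ?_ ?_ <;> simp
      map_smul' := fun a f => by refine coreSum_ext ?_ ?_ <;> simp
      left_inv := fun f => by refine coreSum_ext ?_ ?_ <;> simp
      right_inv := fun f => by refine coreSum_ext ?_ ?_ <;> simp
      norm_map' := fun f => by
        rw [← sq_eq_sq₀ (norm_nonneg _) (norm_nonneg _), WithLp.prod_norm_sq_eq_of_L2,
          WithLp.prod_norm_sq_eq_of_L2]
        change ‖ρ γ f.fst‖ ^ 2 + ‖lpMap (fun n => σ n γ) f.snd‖ ^ 2 = _
        rw [LinearIsometryEquiv.norm_map, LinearIsometryEquiv.norm_map] }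
  map_one' := by
    ext1 f
    refine coreSum_ext ?_ ?_
    · change ρ 1 f.fst = f.fst
      rw [map_one]; rfl
    · ext n
      change σ n 1 (f.snd n) = f.snd n
      rw [map_one]; rfl
  map_mul' γ γ' := by
    ext1 f
    refine coreSum_ext ?_ ?_
    · change ρ (γ * γ') f.fst = ρ γ (ρ γ' f.fst)
      rw [map_mul]; rfl
    · ext n
      change σ n (γ * γ') (f.snd n) = σ n γ (σ n γ' (f.snd n))
      rw [map_mul]; rfl

theorem sumRep_fst {Γ : Type w} [CommGroup Γ] (ρ : Γ →* (V ≃ₗᵢ[ℂ] V))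
    (σ : ∀ n, Γ →* (W n ≃ₗᵢ[ℂ] W n)) (γ : Γ) (f : CoreSum V W) :
    (sumRep ρ σ γ f).fst = ρ γ f.fst := rfl

theorem sumRep_snd {Γ : Type w} [CommGroup Γ] (ρ : Γ →* (V ≃ₗᵢ[ℂ] V))
    (σ : ∀ n, Γ →* (W n ≃ₗᵢ[ℂ] W n)) (γ : Γ) (f : CoreSum V W) (n : ℕ) :
    (sumRep ρ σ γ f).snd n = σ n γ (f.snd n) := rfl

/-- The summand `V` of `V ⊕ ⨁ₙ Wₙ`. -/
def coreSubspace (V : Type u) (W : ℕ → Type v) [NormedAddCommGroup V] [InnerProductSpace ℂ V]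
    [∀ n, NormedAddCommGroup (W n)] [∀ n, InnerProductSpace ℂ (W n)] :
    Submodule ℂ (CoreSum V W) where
  carrier := {f | f.snd = 0}
  add_mem' := fun {f g} (hf : _ = _) (hg : _ = _) => by
    change (f + g).snd = 0
    rw [WithLp.add_snd, hf, hg, add_zero]
  zero_mem' := rfl
  smul_mem' := fun a f (hf : _ = _) => by
    change (a • f).snd = 0
    rw [WithLp.smul_snd, hf, smul_zero]

theorem mem_coreSubspace {f : CoreSum V W} : f ∈ coreSubspace V W ↔ f.snd = 0 := Iff.rfl

theorem mem_map_zpow {E : Type v} [NormedAddCommGroup E] [NormedSpace ℂ E] (T : E ≃ₗᵢ[ℂ] E)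
    (L : Submodule ℂ E) (f : E) :
    f ∈ L.map T.toLinearEquiv.toLinearMap ↔ T⁻¹ f ∈ L := by
  constructor
  · rintro ⟨g, hg, rfl⟩
    have : T⁻¹ (T g) = g := T.symm_apply_apply g
    exact this.symm ▸ hg
  · intro h
    exact ⟨_, h, T.apply_symm_apply f⟩

/-- The GMRA on `V ⊕ ⨁ₙ Wₙ` with dilation `δ = T⁻¹` and subspaces `V_j = T^{-j}(V)`. -/
def coreGMRA [CompleteSpace (CoreSum V W)] {Γ : Type w} [CommGroup Γ] (α : Γ →* Γ)
    {A : V →ₗᵢ[ℂ] V} {B : W 0 →ₗᵢ[ℂ] V} (h : IsCuntzPair A B)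
    (D : ∀ n, W n ≃ₗᵢ[ℂ] W (n + 1)) (hA : IsPureIsometry A)
    (ρ : Γ →* (V ≃ₗᵢ[ℂ] V)) (σ : ∀ n, Γ →* (W n ≃ₗᵢ[ℂ] W n))
    (hρ : ∀ γ v, A (ρ γ v) = ρ (α γ) (A v)) (hσ : ∀ γ v, B (σ 0 γ v) = ρ (α γ) (B v))
    (hD : ∀ n γ v, σ (n + 1) γ (D n v) = D n (σ n (α γ) v)) : GMRA α (CoreSum V W) :=
  have hT : ∀ γ f, invDilation h D (sumRep ρ σ γ f) = sumRep ρ σ (α γ) (invDilation h D f) :=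
    fun γ f => by
      refine coreSum_ext ?_ ?_
      · rw [invDilation_fst, sumRep_fst, sumRep_snd, hρ, hσ, sumRep_fst, invDilation_fst, map_add]
      · ext n
        rw [invDilation_snd, sumRep_snd, sumRep_snd, invDilation_snd,
          LinearIsometryEquiv.symm_apply_eq, ← hD, LinearIsometryEquiv.apply_symm_apply]
  have hmem : ∀ (j : ℤ) f,
      f ∈ (coreSubspace V W).map ((invDilation h D) ^ (-j)).toLinearEquiv.toLinearMap ↔
        ((invDilation h D) ^ j) f ∈ coreSubspace V W := fun j f => by
    rw [mem_map_zpow, ← zpow_neg, neg_neg]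
  have hV0 : ∀ f ∈ coreSubspace V W, invDilation h D f ∈ coreSubspace V W := fun f hf => by
    rw [mem_coreSubspace] at hf ⊢
    ext n
    rw [invDilation_snd, hf]
    simp
  { π := sumRep ρ σ
    δ := (invDilation h D)⁻¹
    conj_π := fun γ => by
      rw [inv_inv, mul_inv_eq_iff_eq_mul]
      exact LinearIsometryEquiv.ext (hT γ)
    V := fun j => (coreSubspace V W).map ((invDilation h D) ^ (-j)).toLinearEquiv.toLinearMap
    isClosed := fun j => by
      have h1 : IsClosed {f : CoreSum V W | (((invDilation h D) ^ j) f).snd = 0} :=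
        isClosed_eq (continuous_snd.comp ((WithLp.prod_continuous_ofLp 2 _ _).comp
          (LinearIsometryEquiv.continuous _))) continuous_const
      have h2 : (((coreSubspace V W).map ((invDilation h D) ^ (-j)).toLinearEquiv.toLinearMap :
          Submodule ℂ (CoreSum V W)) : Set (CoreSum V W)) =
          {f : CoreSum V W | (((invDilation h D) ^ j) f).snd = 0} := Set.ext (hmem j)
      rw [h2]
      exact h1
    mono := fun j f hf => by
      rw [hmem] at hf ⊢
      rw [add_comm, zpow_one_add]
      exact hV0 _ hf
    dilate := fun j => by
      ext f
      refine (hmem (j + 1) f).trans ?_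
      rw [mem_map_zpow, inv_inv, hmem, zpow_add_one]
      rfl
    iInter := by
      have hpow : ∀ (n : ℕ) (f : CoreSum V W), f.snd = 0 →
          (((invDilation h D) ^ n) f).snd = 0 ∧ (((invDilation h D) ^ n) f).fst = A^[n] f.fst := by
        intro n
        induction n with
        | zero => intro f hf; exact ⟨hf, rfl⟩
        | succ n ih =>
          intro f hf
          obtain ⟨h1, h2⟩ := ih f hf
          rw [pow_succ']
          refine ⟨hV0 _ h1, ?_⟩
          change (invDilation h D (((invDilation h D) ^ n) f)).fst = _
          rw [invDilation_fst, h1, h2, Function.iterate_succ_apply']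
          simp
      refine Set.eq_singleton_iff_unique_mem.2 ⟨Set.mem_iInter.2 fun j => Submodule.zero_mem _, ?_⟩
      intro f hf
      rw [Set.mem_iInter] at hf
      have h0 : f.snd = 0 := (hmem 0 f).1 (hf 0)
      have h1 : f.fst ∈ ⋂ n : ℕ, Set.range (A^[n]) := by
        refine Set.mem_iInter.2 fun n => ?_
        have h2 := (hmem (-n) f).1 (hf (-n))
        refine ⟨(((invDilation h D) ^ (-n : ℤ)) f).fst, ?_⟩
        rw [← (hpow n _ h2).2, ← zpow_natCast]
        change ((((invDilation h D) ^ (n : ℤ)) * ((invDilation h D) ^ (-n : ℤ))) f).fst = _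
        rw [← zpow_add, add_neg_cancel, zpow_zero]
        rfl
      rw [hA] at h1
      refine coreSum_ext ?_ ?_
      · exact h1
      · exact h0
    dense := by
      have hpow : ∀ (n k : ℕ) (f : CoreSum V W), (∀ i, n + k ≤ i → f.snd i = 0) →
          ∀ i, k ≤ i → (((invDilation h D) ^ n) f).snd i = 0 := by
        intro n
        induction n with
        | zero => intro k f hf i hi; exact hf i (by omega)
        | succ n ih =>
          intro k f hf i hi
          rw [pow_succ']
          change (invDilation h D (((invDilation h D) ^ n) f)).snd i = 0
          rw [invDilation_snd, ih (k + 1) f (fun i hi => hf i (by omega)) (i + 1) (by omega),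
            map_zero]
      intro f
      have hs : Filter.Tendsto (fun n : ℕ => (WithLp.toLp 2
          (f.fst, ∑ i ∈ Finset.range n, lp.single 2 i (f.snd i)) : CoreSum V W))
          Filter.atTop (nhds f) := by
        have h1 := (lp.hasSum_single (by norm_num) f.snd).tendsto_sum_nat
        exact ((WithLp.prod_continuous_toLp 2 _ _).tendsto _).comp
          ((tendsto_const_nhds (x := f.fst)).prodMk_nhds h1)
      refine mem_closure_of_tendsto hs (Filter.Eventually.of_forall fun n => ?_)
      refine Set.mem_iUnion.2 ⟨n, (hmem n _).2 ?_⟩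
      rw [zpow_natCast, mem_coreSubspace]
      ext i
      refine hpow n 0 _ (fun i hi => ?_) i (Nat.zero_le _)
      change (∑ i ∈ Finset.range n, lp.single 2 i (f.snd i) : lp W 2) i = 0
      rw [lp.coeFn_sum, Finset.sum_apply]
      refine Finset.sum_eq_zero fun k hk => lp.single_apply_ne _ _ _ ?_
      have := Finset.mem_range.1 hk
      omega
    invariant := fun γ f hf => by
      rw [hmem] at hf ⊢
      rw [zpow_zero] at hf ⊢
      change (sumRep ρ σ γ f).snd = 0
      replace hf : f.snd = 0 := hf
      ext n
      rw [sumRep_snd, hf]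
      simp }

end abstractGMRA

namespace DilationData

variable {Γ : Type u} [CommGroup Γ] [TopologicalSpace Γ] [DiscreteTopology Γ]

/-- A multiplicity function: Borel, and `m(ω) ≤ ∑_{α* ζ = ω} m(ζ)` for almost every `ω`. -/
structure IsMultiplicity (S : DilationData Γ) (m : PontryaginDual Γ → ℕ) : Prop where
  measurable : Measurable m
  consistency : ∀ᵐ ω ∂(haarDual Γ), m ω ≤ ∑' ζ : {ζ // S.dual ζ = ω}, m ζ

/-- The function `m̃(ω) = ∑_{α* ζ = ω} m(ζ) - m(ω)`. -/
def complMult (S : DilationData Γ) (m : PontryaginDual Γ → ℕ) (ω : PontryaginDual Γ) : ℕ :=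
  (∑' ζ : {ζ // S.dual ζ = ω}, m ζ) - m ω

/-- `H` is a filter relative to `m` and `α*`. Matrix indices start at zero, so that the entry
`(i, j)` here is `h_{i+1,j+1}` in the usual indexing. -/
structure IsFilter (S : DilationData Γ) (m : PontryaginDual Γ → ℕ)
    (H : PontryaginDual Γ → Matrix ℕ ℕ ℂ) : Prop where
  measurable : ∀ i j, Measurable fun ω => H ω i j
  support : ∀ i j, ∀ᵐ ω ∂(haarDual Γ), ω ∉ level m j → H ω i j = 0
  filter_eq : ∀ i i', ∀ᵐ ω ∂(haarDual Γ),
    ∑' ζ : {ζ // S.dual ζ = ω}, ∑' j, H ζ i j * conj (H ζ i' j) =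
      (S.N : ℂ) * (if i = i' then 1 else 0) * (level m i).indicator 1 ω

/-- `G` is a complementary filter to `H`. -/
structure IsComplementaryFilter (S : DilationData Γ) (m : PontryaginDual Γ → ℕ)
    (H G : PontryaginDual Γ → Matrix ℕ ℕ ℂ) : Prop where
  measurable : ∀ k j, Measurable fun ω => G ω k j
  support : ∀ k j, ∀ᵐ ω ∂(haarDual Γ), ω ∉ level m j → G ω k j = 0
  filter_eq : ∀ k k', ∀ᵐ ω ∂(haarDual Γ),
    ∑' ζ : {ζ // S.dual ζ = ω}, ∑' j, G ζ k j * conj (G ζ k' j) =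
      (S.N : ℂ) * (if k = k' then 1 else 0) * (level (S.complMult m) k).indicator 1 ω
  orthogonal : ∀ k i, ∀ᵐ ω ∂(haarDual Γ),
    ∑' ζ : {ζ // S.dual ζ = ω}, ∑' j, G ζ k j * conj (H ζ i j) = 0

section rows

variable {S : DilationData Γ} {m : PontryaginDual Γ → ℕ} {H G : PontryaginDual Γ → Matrix ℕ ℕ ℂ}

theorem finite_level (m : PontryaginDual Γ → ℕ) (ω : PontryaginDual Γ) :
    {i | ω ∈ level m i}.Finite := Set.finite_lt_nat (m ω)

theorem measurable_complMult [Countable Γ] (hm : Measurable m) : Measurable (S.complMult m) := by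
  have := Fintype.ofFinite S.K
  have h1 : ∀ ω, S.complMult m ω = (∑ κ : S.K, m (κ * S.c ω)) - m ω := fun ω => by
    rw [complMult, IsRowSystem.tsum_fibre S ω m, finsum_eq_sum_of_fintype]
  have h2 : Measurable fun ω => ∑ κ : S.K, m (κ * S.c ω) :=
    Finset.measurable_sum _ fun κ _ => hm.comp (S.measurable_mul_c κ)
  rw [show S.complMult m = fun ω => (∑ κ : S.K, m (κ * S.c ω)) - m ω from funext h1]
  exact h2.sub hm

theorem IsFilter.isRowSystem (hm : S.IsMultiplicity m) (hH : S.IsFilter m H) :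
    IsRowSystem S m (level m) fun ω i j => H ω i j where
  measurable_m := hm.measurable
  measurable_s := measurableSet_level hm.measurable
  finite := Eventually.of_forall (finite_level m)
  measurable := hH.measurable
  support i j := (hH.support i j).mono fun ω h hj => h fun (h2 : j < m ω) => by omega
  rows i i' := by
    filter_upwards [hH.filter_eq i i'] with ω h
    rw [h]
    refine ⟨fun h1 h2 => ?_, fun h1 => ?_⟩
    · rw [indicator_of_mem h1, h2]
      simp
    · by_cases h2 : i = i'
      · rw [indicator_of_notMem (fun h3 => h1 ⟨h3, h2⟩), mul_zero]
      · simp [h2]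

theorem IsComplementaryFilter.isRowSystem [Countable Γ] (hm : S.IsMultiplicity m)
    (hG : S.IsComplementaryFilter m H G) :
    IsRowSystem S m (fun k : ULift.{u} ℕ => level (S.complMult m) k.down)
      fun ω k j => G ω k.down j where
  measurable_m := hm.measurable
  measurable_s k := measurableSet_level (measurable_complMult hm.measurable) k.down
  finite := Eventually.of_forall fun ω =>
    (finite_level (S.complMult m) ω).preimage ULift.down_injective.injOn
  measurable k j := hG.measurable k.down j
  support k j := (hG.support k.down j).mono fun ω h hj => h fun (h2 : j < m ω) => by omega
  rows k k' := by
    filter_upwards [hG.filter_eq k.down k'.down] with ω h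
    rw [h]
    refine ⟨fun h1 h2 => ?_, fun h1 => ?_⟩
    · rw [indicator_of_mem h1, h2]
      simp
    · by_cases h2 : k = k'
      · rw [indicator_of_notMem (fun h3 => h1 ⟨h3, h2⟩), mul_zero]
      · rw [if_neg fun h3 => h2 (ULift.down_injective h3), mul_zero, zero_mul]

/-- The rows of `H` and of `G` together. -/
theorem IsComplementaryFilter.joint [Countable Γ] (hm : S.IsMultiplicity m)
    (hH : S.IsFilter m H) (hG : S.IsComplementaryFilter m H G) :
    IsRowSystem S m (Sum.elim (level m) fun k : ULift.{u} ℕ => level (S.complMult m) k.down)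
      fun ω p j => Sum.elim (fun i => H ω i j) (fun k : ULift.{u} ℕ => G ω k.down j) p where
  measurable_m := hm.measurable
  measurable_s := by
    rintro (i | k)
    · exact (hH.isRowSystem hm).measurable_s i
    · exact (hG.isRowSystem hm).measurable_s k
  finite := by
    filter_upwards [(hH.isRowSystem hm).finite, (hG.isRowSystem hm).finite] with ω h1 h2
    refine ((h1.image Sum.inl).union (h2.image Sum.inr)).subset ?_
    rintro (i | k) hi
    · exact Or.inl ⟨i, hi, rfl⟩
    · exact Or.inr ⟨k, hi, rfl⟩
  measurable := by
    rintro (i | k) j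
    · exact hH.measurable i j
    · exact hG.measurable k.down j
  support := by
    rintro (i | k) j
    · exact (hH.isRowSystem hm).support i j
    · exact (hG.isRowSystem hm).support k j
  rows := by
    rintro (i | k) (i' | k')
    · filter_upwards [(hH.isRowSystem hm).rows i i'] with ω h
      simpa only [Sum.elim_inl, Sum.inl.injEq] using h
    · filter_upwards [hG.orthogonal k'.down i] with ω h
      refine ⟨fun _ (h2 : _ = _) => (by cases h2), fun _ => ?_⟩
      have h2 := congrArg conj h
      rw [map_zero, Complex.conj_tsum] at h2
      refine Eq.trans (tsum_congr fun ζ => ?_) h2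
      rw [Complex.conj_tsum]
      refine tsum_congr fun j => ?_
      simp [mul_comm]
    · filter_upwards [hG.orthogonal k.down i'] with ω h
      exact ⟨fun _ (h2 : _ = _) => (by cases h2), fun _ => h⟩
    · filter_upwards [(hG.isRowSystem hm).rows k k'] with ω h
      simpa only [Sum.elim_inr, Sum.inr.injEq] using h

theorem joint_ncard (hm : S.IsMultiplicity m) : ∀ᵐ ω ∂(haarDual Γ),
    {p | ω ∈ (Sum.elim (level m) fun k : ULift.{u} ℕ => level (S.complMult m) k.down) p}.ncard =
      ∑' ζ : {ζ // S.dual ζ = ω}, m ζ := by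
  filter_upwards [hm.consistency] with ω h
  have e : {p | ω ∈ (Sum.elim (level m) fun k : ULift.{u} ℕ => level (S.complMult m) k.down) p} =
      Sum.inl '' (Set.Iio (m ω)) ∪
        (fun n : ℕ => Sum.inr (ULift.up n)) '' (Set.Iio (S.complMult m ω)) := by
    ext p
    rcases p with i | k
    · simp [level]
    · constructor
      · exact fun h => Or.inr ⟨k.down, h, rfl⟩
      · rintro (⟨a, _, ha⟩ | ⟨a, h1, ha⟩)
        · cases ha
        · cases ha
          exact h1
  have h1 : ∀ n : ℕ, (Set.Iio n).ncard = n := fun n => by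
    rw [← Finset.coe_Iio, Set.ncard_coe_finset, Nat.card_Iio]
  rw [e, Set.ncard_union_eq, Set.ncard_image_of_injective _ Sum.inl_injective,
    Set.ncard_image_of_injective _ (fun a b hab => ULift.up_injective (Sum.inr_injective hab)),
    h1, h1, complMult]
  · omega
  · rw [Set.disjoint_left]
    rintro _ ⟨a, _, rfl⟩ ⟨b, _, hb⟩
    cases hb

end rows

section sums

variable [Countable Γ] {S : DilationData Γ} {m : PontryaginDual Γ → ℕ}
  {ι : Type v} {κ : Type w} [Countable ι] [Countable κ]
  {s : ι → Set (PontryaginDual Γ)} {t : κ → Set (PontryaginDual Γ)}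
  {Q : PontryaginDual Γ → ι → ℕ → ℂ} {R : PontryaginDual Γ → κ → ℕ → ℂ}

theorem ruelle_sum (hQ : IsRowSystem S m s Q) (hR : IsRowSystem S m t R)
    (h : IsRowSystem S m (Sum.elim s t)
      fun ω p j => Sum.elim (fun i => Q ω i j) (fun k => R ω k j) p)
    (f : L2Sets (Sum.elim s t)) (v : L2Sets s) (w : L2Sets t)
    (hv : ∀ i, f (Sum.inl i) =ᵐ[(haarDual Γ).restrict (s i)] v i)
    (hw : ∀ k, f (Sum.inr k) =ᵐ[(haarDual Γ).restrict (t k)] w k) :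
    ruelle h f = ruelle hQ v + ruelle hR w :=
  L2Sum.ext_ae fun j => by
    have h0 : ∀ p, f p =ᵐ[(haarDual Γ).restrict ((Sum.elim s t) p)]
        (Sum.elim (fun i => (v i : PontryaginDual Γ → ℂ)) (fun k => w k) :
          ι ⊕ κ → PontryaginDual Γ → ℂ) p := by
      rintro (i | k)
      · exact hv i
      · exact hw k
    filter_upwards [ruelle_ae h f j, ae_restrict_of_ae (h.ruelleFun_congr h0),
      ruelle_ae hQ v j, ruelle_ae hR w j, L2Sum.add_ae (ruelle hQ v) (ruelle hR w) j,
      ae_restrict_of_ae (hQ.summable_ruelleFun fun i => v i),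
      ae_restrict_of_ae (hR.summable_ruelleFun fun k => w k)] with ω h1 h2 h3 h4 h5 h6 h7
    rw [h1, h2, h5, h3, h4]
    exact HasSum.tsum_eq ((h6 j).hasSum.sum (h7 j).hasSum)

theorem norm_sum (f : L2Sets (Sum.elim s t)) (v : L2Sets s) (w : L2Sets t)
    (hv : ∀ i, f (Sum.inl i) =ᵐ[(haarDual Γ).restrict (s i)] v i)
    (hw : ∀ k, f (Sum.inr k) =ᵐ[(haarDual Γ).restrict (t k)] w k) :
    ‖f‖ ^ 2 = ‖v‖ ^ 2 + ‖w‖ ^ 2 := by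
  have h1 := L2Sum.tsum_lintegral f
  rw [Summable.tsum_sum ENNReal.summable ENNReal.summable] at h1
  have h2 := L2Sum.tsum_lintegral_congr v (fun i => f (Sum.inl i)) fun i => (hv i).symm
  have h3 := L2Sum.tsum_lintegral_congr w (fun k => f (Sum.inr k)) fun k => (hw k).symm
  replace h1 := (congrArg₂ (· + ·) h2 h3).symm.trans h1
  rw [← ENNReal.ofReal_add (by positivity) (by positivity),
    ENNReal.ofReal_eq_ofReal_iff (by positivity) (by positivity)] at h1
  exact h1.symm

theorem exists_joint (v : L2Sets s) (w : L2Sets t) :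
    ∃ f : L2Sets (Sum.elim s t),
      (∀ i, f (Sum.inl i) =ᵐ[(haarDual Γ).restrict (s i)] v i) ∧
      (∀ k, f (Sum.inr k) =ᵐ[(haarDual Γ).restrict (t k)] w k) := by
  let x : ι ⊕ κ → PontryaginDual Γ → ℂ := Sum.elim (fun i => v i) (fun k => w k)
  have hx : ∀ p, AEStronglyMeasurable (x p) ((haarDual Γ).restrict (Sum.elim s t p)) := by
    rintro (i | k)
    · exact (Lp.stronglyMeasurable (v i)).aestronglyMeasurable
    · exact (Lp.stronglyMeasurable (w k)).aestronglyMeasurable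
  have hn : ∑' p, ∫⁻ ω, ‖x p ω‖ₑ ^ 2 ∂((haarDual Γ).restrict (Sum.elim s t p)) ≠ ∞ := by
    rw [Summable.tsum_sum ENNReal.summable ENNReal.summable]
    change (∑' i, ∫⁻ ω, ‖v i ω‖ₑ ^ 2 ∂((haarDual Γ).restrict (s i))) +
      (∑' k, ∫⁻ ω, ‖w k ω‖ₑ ^ 2 ∂((haarDual Γ).restrict (t k))) ≠ ∞
    rw [L2Sum.tsum_lintegral v, L2Sum.tsum_lintegral w]
    exact ENNReal.add_ne_top.2 ⟨ENNReal.ofReal_ne_top, ENNReal.ofReal_ne_top⟩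
  exact ⟨L2Sum.ofFun x hx hn, fun i => L2Sum.ofFun_ae x hx hn (Sum.inl i),
    fun k => L2Sum.ofFun_ae x hx hn (Sum.inr k)⟩

theorem exists_parts (f : L2Sets (Sum.elim s t)) :
    ∃ (v : L2Sets s) (w : L2Sets t),
      (∀ i, f (Sum.inl i) =ᵐ[(haarDual Γ).restrict (s i)] v i) ∧
      (∀ k, f (Sum.inr k) =ᵐ[(haarDual Γ).restrict (t k)] w k) := by
  have h1 := L2Sum.tsum_lintegral f
  rw [Summable.tsum_sum ENNReal.summable ENNReal.summable] at h1
  have h2 := h1.trans_ne ENNReal.ofReal_ne_top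
  obtain ⟨h3, h4⟩ := ENNReal.add_ne_top.1 h2
  exact ⟨L2Sum.ofFun (fun i => f (Sum.inl i))
      (fun i => (Lp.stronglyMeasurable (f (Sum.inl i))).aestronglyMeasurable) h3,
    L2Sum.ofFun (fun k => f (Sum.inr k))
      (fun k => (Lp.stronglyMeasurable (f (Sum.inr k))).aestronglyMeasurable) h4,
    fun i => (L2Sum.ofFun_ae _ _ h3 i).symm, fun k => (L2Sum.ofFun_ae _ _ h4 k).symm⟩

end sums

section canonical

variable (S : DilationData Γ)

/-- The index set of the direct sum `𝒲ₙ`: pairs of `k` and an `n`-tuple in the kernel of `α*`.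
(`ULift` only adjusts the universe level of `ℕ`.) -/
def wIndex : ℕ → Type u
  | 0 => ULift.{u} ℕ
  | n + 1 => wIndex n × S.K

/-- The measures of the summands of `𝒲ₙ`: for `𝒲₀ = ⨁ₖ L²(σ̃ₖ)` restrictions of Haar measure,
and then those of the dilated spaces `𝒲ₙ₊₁ = D(𝒲ₙ)`. -/
def wMeasure (m : PontryaginDual Γ → ℕ) : ∀ n, S.wIndex n → Measure (PontryaginDual Γ)
  | 0 => fun k => (haarDual Γ).restrict (level (S.complMult m) (ULift.down k))
  | n + 1 => S.dilMeasure (wMeasure m n)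

/-- The core space `𝒱₀ = ⨁ᵢ L²(σᵢ)`. -/
abbrev CoreV (m : PontryaginDual Γ → ℕ) : Type u := L2Sets (level m)

/-- The spaces `𝒲ₙ`, with `𝒲₀ = ⨁ₖ L²(σ̃ₖ)` and `𝒲ₙ₊₁ = D(𝒲ₙ)`. -/
abbrev SpaceW (m : PontryaginDual Γ → ℕ) (n : ℕ) : Type u := L2Sum (S.wMeasure m n)

/-- The operator `D : 𝒲ₙ → 𝒲ₙ₊₁`. -/
def dilW [Countable Γ] (m : PontryaginDual Γ → ℕ) (n : ℕ) :
    S.SpaceW m n ≃ₗᵢ[ℂ] S.SpaceW m (n + 1) :=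
  S.dilation (S.wMeasure m n)

/-- The Hilbert space `𝒱₀ ⊕ ⨁ₙ 𝒲ₙ`. -/
abbrev CanonicalSpace (m : PontryaginDual Γ → ℕ) : Type u := CoreSum (CoreV m) (S.SpaceW m)

variable {S} {m : PontryaginDual Γ → ℕ} {H G : PontryaginDual Γ → Matrix ℕ ℕ ℂ}

/-- The Ruelle operator `[S_H f](ω) = H(ω)ᵗ f(α* ω)` on `⨁ᵢ L²(σᵢ)`. -/
def ruelleH [Countable Γ] (hm : S.IsMultiplicity m) (hH : S.IsFilter m H) :
    CoreV m →ₗᵢ[ℂ] CoreV m :=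
  ruelle (hH.isRowSystem hm)

/-- The Ruelle operator `[S_G f](ω) = G(ω)ᵗ f(α* ω)` from `⨁ₖ L²(σ̃ₖ)` to `⨁ᵢ L²(σᵢ)`. -/
def ruelleG [Countable Γ] (hm : S.IsMultiplicity m) (hG : S.IsComplementaryFilter m H G) :
    L2Sets (fun k : ULift.{u} ℕ => level (S.complMult m) k.down) →ₗᵢ[ℂ] CoreV m :=
  ruelle (hG.isRowSystem hm)

theorem isCuntzPair [Countable Γ] (hm : S.IsMultiplicity m) (hH : S.IsFilter m H)
    (hG : S.IsComplementaryFilter m H G) : IsCuntzPair (ruelleH hm hH) (ruelleG hm hG) where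
  norm_sq v w := by
    obtain ⟨f, h1, h2⟩ := exists_joint (t := fun k : ULift.{u} ℕ =>
      level (S.complMult m) k.down) v w
    have h3 := ruelle_sum (hH.isRowSystem hm) (hG.isRowSystem hm) (hG.joint hm hH) f v w h1 h2
    have h4 := norm_sum f v w h1 h2
    refine Eq.trans ?_ h4
    rw [← LinearIsometry.norm_map (ruelle (hG.joint hm hH)) f, h3]
    rfl
  surj u := by
    obtain ⟨f, hf⟩ := (hG.joint hm hH).surjective (joint_ncard hm) u
    obtain ⟨v, w, h1, h2⟩ := exists_parts f
    refine ⟨v, w, ?_⟩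
    rw [← hf]
    exact (ruelle_sum (hH.isRowSystem hm) (hG.isRowSystem hm) (hG.joint hm hH) f v w h1 h2).symm

end canonical

/-- The parameters of a canonical GMRA: a multiplicity function `m`, a filter `H` relative to `m`
and `α*` whose Ruelle operator is a pure isometry, and a complementary filter `G` to `H`. -/
structure GMRAParameters [Countable Γ] (S : DilationData Γ) where
  m : PontryaginDual Γ → ℕ
  H : PontryaginDual Γ → Matrix ℕ ℕ ℂ
  G : PontryaginDual Γ → Matrix ℕ ℕ ℂ
  isMultiplicity : S.IsMultiplicity m
  isFilter : S.IsFilter m H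
  isComplementaryFilter : S.IsComplementaryFilter m H G
  pure : IsPureIsometry (ruelleH isMultiplicity isFilter)

/-- The canonical GMRA with parameters `m`, `H`, `G`: it lives in `ℋ = 𝒱₀ ⊕ ⨁ₙ 𝒲ₙ`, with
`π_γ` multiplication by `ω(γ)`, dilation `δ = T⁻¹` for the unitary operator
`T f = (S_H f_{𝒱₀} + S_G f_{𝒲₀}, D⁻¹ f_{𝒲₁}, D⁻¹ f_{𝒲₂}, …)`, and `V_j = T^{-j}(𝒱₀)`. -/
def GMRAParameters.canonicalGMRA [Countable Γ] {S : DilationData Γ} (P : S.GMRAParameters) :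
    GMRA S.α (S.CanonicalSpace P.m) :=
  coreGMRA S.α (isCuntzPair P.isMultiplicity P.isFilter P.isComplementaryFilter) (S.dilW P.m)
    P.pure (charRep _) (fun n => charRep (S.wMeasure P.m n))
    (charRep_ruelle (P.isFilter.isRowSystem P.isMultiplicity))
    (charRep_ruelle (P.isComplementaryFilter.isRowSystem P.isMultiplicity))
    (fun n γ f => charRep_dilation (S.wMeasure P.m n) S γ f)

/-- A matrix-valued Borel function `A` on the dual group of the form `diag(A₁(ω), 0)`, where
`A₁(ω)` is a unitary matrix of dimension `m(ω)`. -/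
structure IsBlockUnitary (m : PontryaginDual Γ → ℕ) (A : PontryaginDual Γ → Matrix ℕ ℕ ℂ) :
    Prop where
  measurable : ∀ i j, Measurable fun ω => A ω i j
  unitary : ∀ ω, (A ω).submatrix (Fin.val : Fin (m ω) → ℕ) (Fin.val : Fin (m ω) → ℕ) ∈
    Matrix.unitaryGroup (Fin (m ω)) ℂ
  zero : ∀ ω i j, m ω ≤ i ∨ m ω ≤ j → A ω i j = 0

end DilationData

end

/-!
A canonical GMRA is determined up to equivalence by its core `𝒱₀ = ⨁ᵢ L²(σᵢ)`, together with the
multiplications by characters and the Ruelle operator `S_H`. Indeed `T` restricts to `S_H` on `𝒱₀`,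
so an equivalence restricts to a unitary operator between the cores that commutes with the
characters and intertwines the Ruelle operators. Conversely, such an operator `U` maps the range of
`S_G`, being the orthogonal complement of the range of `S_H`, onto the range of `S_{G'}`; this gives
`𝒲₀ → 𝒲'₀`, and conjugating with the dilations `D` gives `𝒲ₙ → 𝒲'ₙ` for all `n`
(`coreGMRA_equivalent_iff`).

An isometry of the cores commuting with the characters commutes with multiplication by all
functions in `L²`, because the characters span a dense subspace (`apply_compVec_ae`). Hence it is
multiplication by a matrix-valued function `A`, whose `i`-th column is the image of the vector with
`i`-th component `1` and other components `0` (`mulOp_opMatrix`). Comparing norms of vectors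
supported in arbitrary Borel sets shows that the `m'(ω) × m(ω)` corner of `A(ω)` has orthonormal
columns almost everywhere (`isColumnIsometry_opMatrix`), so `m ≤ m'` (`IsColumnIsometry.ae_le`).
For a unitary operator, the same holds for the inverse; therefore `m = m'` and the corner is
unitary. Conversely, a block unitary `A` acts as a unitary operator, inverted by its conjugate
transpose (`mulOp_mulOp_conjTranspose`). Finally, that `A` intertwines `S_H` and `S_{H'}` need only
be tested on vectors with a single nonzero component, equal to `1`, where it is the identity
`H Aᵗ = (Aᵗ ∘ α*) H'` (`mulOp_ruelleH_iff`).
-/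

noncomputable section

set_option linter.unusedSectionVars false

namespace DilationData

variable {Γ : Type u} [CommGroup Γ] [TopologicalSpace Γ] [DiscreteTopology Γ]

/-! ### Density of the characters in `L²` -/

/-- Evaluation at `γ`, as a continuous complex-valued function on the dual group. -/
def evalChar (γ : Γ) : C(PontryaginDual Γ, ℂ) where
  toFun ω := ((ω γ : Circle) : ℂ)
  continuous_toFun := continuous_subtype_val.comp <|
    (continuous_eval_const (F := C(Γ, Circle)) γ).comp
      (ContinuousMonoidHom.isInducing_toContinuousMap Γ Circle).continuous

theorem evalChar_apply (γ : Γ) (ω : PontryaginDual Γ) : evalChar γ ω = ((ω γ : Circle) : ℂ) := rfl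

variable (Γ) in
/-- The star subalgebra of `C(Γ̂, ℂ)` generated by the evaluations at elements of `Γ`. -/
def charSubalgebra : StarSubalgebra ℂ C(PontryaginDual Γ, ℂ) where
  toSubalgebra := Algebra.adjoin ℂ (range evalChar)
  star_mem' := by
    change Algebra.adjoin ℂ (range (evalChar (Γ := Γ))) ≤
      star (Algebra.adjoin ℂ (range (evalChar (Γ := Γ))))
    refine Algebra.adjoin_le ?_
    rintro - ⟨γ, rfl⟩
    refine Algebra.subset_adjoin ⟨γ⁻¹, ContinuousMap.ext fun ω => ?_⟩
    change ((ω γ⁻¹ : Circle) : ℂ) = conj ((ω γ : Circle) : ℂ)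
    rw [map_inv, Circle.coe_inv_eq_conj]

theorem charSubalgebra_coe : Subalgebra.toSubmodule (charSubalgebra Γ).toSubalgebra =
    Submodule.span ℂ (range (evalChar (Γ := Γ))) := by
  apply Algebra.adjoin_eq_span_of_subset
  refine Subset.trans ?_ Submodule.subset_span
  intro x hx
  refine Submonoid.closure_induction (fun _ => id) ⟨1, ?_⟩ ?_ hx
  · ext1 ω
    rw [evalChar_apply, map_one, Circle.coe_one, ContinuousMap.one_apply]
  · rintro - - - - ⟨γ, rfl⟩ ⟨γ', rfl⟩
    refine ⟨γ * γ', ?_⟩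
    ext1 ω
    rw [ContinuousMap.mul_apply, evalChar_apply, map_mul, Circle.coe_mul]
    rfl

theorem charSubalgebra_separatesPoints : (charSubalgebra Γ).SeparatesPoints := by
  intro ω ω' hne
  obtain ⟨γ, hγ⟩ : ∃ γ, ω γ ≠ ω' γ := by
    by_contra! h
    exact hne (PontryaginDual.ext h)
  exact ⟨_, ⟨evalChar γ, Algebra.subset_adjoin ⟨γ, rfl⟩, rfl⟩, fun h => hγ (Circle.ext h)⟩

theorem span_evalChar_closure_eq_top :
    (Submodule.span ℂ (range (evalChar (Γ := Γ)))).topologicalClosure = ⊤ := by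
  rw [← charSubalgebra_coe]
  exact congr_arg (Subalgebra.toSubmodule <| StarSubalgebra.toSubalgebra ·)
    (ContinuousMap.starSubalgebra_topologicalClosure_eq_top_of_separatesPoints (charSubalgebra Γ)
      charSubalgebra_separatesPoints)

variable [Countable Γ]

/-- A set of `L²`-functions that is a closed subspace and contains all characters is everything. -/
theorem eq_top_of_evalChar_mem (μ : Measure (PontryaginDual Γ)) [IsFiniteMeasure μ]
    (L : Submodule ℂ (Lp ℂ 2 μ)) (hL : IsClosed (L : Set (Lp ℂ 2 μ)))
    (h : ∀ γ : Γ, ContinuousMap.toLp 2 μ ℂ (evalChar γ) ∈ L) : L = ⊤ := by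
  have h1 := (ContinuousMap.toLp_denseRange ℂ μ ℂ
    (p := 2) ENNReal.ofNat_ne_top).topologicalClosure_map_submodule
    (span_evalChar_closure_eq_top (Γ := Γ))
  rw [eq_top_iff, ← h1]
  refine Submodule.topologicalClosure_minimal _ ?_ hL
  rw [Submodule.map_span, Submodule.span_le]
  rintro _ ⟨_, ⟨γ, rfl⟩, rfl⟩
  exact h γ

/-- The vector of `⨁ᵢ L²(σᵢ)` whose only nonzero component is the `i`-th, equal to `1`. -/
def unitVec (m : PontryaginDual Γ → ℕ) (i : ℕ) : CoreV m :=
  lp.single 2 i (ContinuousMap.toLp 2 ((haarDual Γ).restrict (level m i)) ℂ 1)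

theorem single_ae {m : PontryaginDual Γ → ℕ} (i : ℕ)
    (g : Lp ℂ 2 ((haarDual Γ).restrict (level m i))) {f : PontryaginDual Γ → ℂ}
    (hf : g =ᵐ[(haarDual Γ).restrict (level m i)] f) (k : ℕ) :
    (lp.single 2 i g : CoreV m) k =ᵐ[(haarDual Γ).restrict (level m k)]
      fun ω => if k = i then f ω else 0 := by
  by_cases h : k = i
  · subst h
    rw [lp.single_apply_self]
    simpa using hf
  · rw [lp.single_apply_ne _ _ _ h]
    simp only [h, if_false]
    exact Lp.coeFn_zero ℂ 2 ((haarDual Γ).restrict (level m k))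

theorem unitVec_ae (m : PontryaginDual Γ → ℕ) (i k : ℕ) :
    unitVec m i k =ᵐ[(haarDual Γ).restrict (level m k)] fun _ => if k = i then 1 else 0 :=
  single_ae i _ (ContinuousMap.coeFn_toLp (𝕜 := ℂ) _ 1) k

theorem charRep_unitVec (m : PontryaginDual Γ → ℕ) (i : ℕ) (γ : Γ) :
    charRep _ γ (unitVec m i) =
      lp.single 2 i (ContinuousMap.toLp 2 ((haarDual Γ).restrict (level m i)) ℂ (evalChar γ)) :=
  L2Sum.ext_ae fun k => by
    filter_upwards [charRep_ae _ γ (unitVec m i) k, unitVec_ae m i k,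
      single_ae i _ (ContinuousMap.coeFn_toLp (𝕜 := ℂ) ((haarDual Γ).restrict (level m i))
        (evalChar γ)) k] with ω h1 h2 h3
    rw [h1, h2, h3]
    split_ifs
    · rw [mul_one, evalChar_apply]
    · rw [mul_zero]

/-- The translates of the vectors `unitVec m i` span a dense subspace, so they determine an
operator. -/
theorem ext_charRep_unitVec {m : PontryaginDual Γ → ℕ} {F : Type*} [NormedAddCommGroup F]
    [NormedSpace ℂ F] {X Y : CoreV m →L[ℂ] F}
    (h : ∀ (γ : Γ) i, X (charRep _ γ (unitVec m i)) = Y (charRep _ γ (unitVec m i))) : X = Y := by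
  refine lp.ext_continuousLinearMap ENNReal.ofNat_ne_top fun i => ?_
  have h1 := eq_top_of_evalChar_mem _
    (LinearMap.eqLocus (X.comp (lp.singleContinuousLinearMap ℂ
      (fun i => Lp ℂ 2 ((haarDual Γ).restrict (level m i))) 2 i)).toLinearMap
      (Y.comp (lp.singleContinuousLinearMap ℂ
      (fun i => Lp ℂ 2 ((haarDual Γ).restrict (level m i))) 2 i)).toLinearMap)
    (isClosed_eq (ContinuousLinearMap.continuous _) (ContinuousLinearMap.continuous _)) fun γ => by
      have := h γ i
      rw [charRep_unitVec] at this
      exact this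
  ext1 g
  have h2 : g ∈ (⊤ : Submodule ℂ _) := trivial
  rw [← h1] at h2
  exact h2

end DilationData

namespace DilationData

variable {Γ : Type u} [CommGroup Γ] [TopologicalSpace Γ] [DiscreteTopology Γ]

/-! ### Multiplication operators -/

/-- A Borel matrix-valued function whose value at almost every `ω` has zero entries outside its
upper left `m'(ω) × m(ω)` corner, and orthonormal columns in that corner. -/
structure IsColumnIsometry (m m' : PontryaginDual Γ → ℕ)
    (A : PontryaginDual Γ → Matrix ℕ ℕ ℂ) : Prop where
  measurable_dom : Measurable m
  measurable_cod : Measurable m'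
  measurable : ∀ j i, Measurable fun ω => A ω j i
  support : ∀ᵐ ω ∂(haarDual Γ), ∀ j i, m' ω ≤ j ∨ m ω ≤ i → A ω j i = 0
  columns : ∀ᵐ ω ∂(haarDual Γ), ∀ i i' : Fin (m ω),
    ∑ j : Fin (m' ω), A ω j i * conj (A ω j i') = if i = i' then 1 else 0

/-- The function `ω ↦ A(ω) x(ω)`, in coordinates. -/
def mulFun (A : PontryaginDual Γ → Matrix ℕ ℕ ℂ) (x : ℕ → PontryaginDual Γ → ℂ) (j : ℕ)
    (ω : PontryaginDual Γ) : ℂ :=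
  ∑' i, A ω j i * x i ω

theorem mulFun_eq_sum {m m' : PontryaginDual Γ → ℕ} {A : PontryaginDual Γ → Matrix ℕ ℕ ℂ}
    {ω : PontryaginDual Γ} (h : ∀ j i, m' ω ≤ j ∨ m ω ≤ i → A ω j i = 0)
    (x : ℕ → PontryaginDual Γ → ℂ) (j : ℕ) :
    mulFun A x j ω = ∑ i : Fin (m ω), A ω j i * x i ω := by
  rw [mulFun, tsum_eq_sum (s := Finset.range (m ω)), Finset.sum_range]
  intro i hi
  rw [h j i (Or.inr (by simpa using hi)), zero_mul]

theorem enorm_sq_eq (z : ℂ) : ‖z‖ₑ ^ 2 = ENNReal.ofReal (‖z‖ ^ 2) := by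
  rw [ENNReal.ofReal_pow (norm_nonneg _), ofReal_norm]

theorem tsum_indicator_level (m : PontryaginDual Γ → ℕ) (F : ℕ → PontryaginDual Γ → ℝ≥0∞)
    (ω : PontryaginDual Γ) :
    ∑' j, (level m j).indicator (F j) ω = ∑ j : Fin (m ω), F j ω := by
  rw [tsum_eq_sum (s := Finset.range (m ω)), Finset.sum_range]
  · exact Finset.sum_congr rfl fun j _ => indicator_of_mem (show ω ∈ level m j from j.2) _
  · exact fun j hj => indicator_of_notMem (fun h : ω ∈ level m j => hj (Finset.mem_range.2 h)) _

theorem ae_level_congr {m : PontryaginDual Γ → ℕ} (hm : Measurable m)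
    {x y : ℕ → PontryaginDual Γ → ℂ}
    (h : ∀ i, x i =ᵐ[(haarDual Γ).restrict (level m i)] y i) :
    ∀ᵐ ω ∂(haarDual Γ), ∀ i, i < m ω → x i ω = y i ω :=
  ae_all_iff.2 fun i => (ae_restrict_iff' (measurableSet_level hm i)).1 (h i)

namespace IsColumnIsometry

variable {m m' : PontryaginDual Γ → ℕ} {A : PontryaginDual Γ → Matrix ℕ ℕ ℂ}

theorem mulFun_congr (h : IsColumnIsometry m m' A) {x y : ℕ → PontryaginDual Γ → ℂ}
    (hxy : ∀ i, x i =ᵐ[(haarDual Γ).restrict (level m i)] y i) :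
    ∀ᵐ ω ∂(haarDual Γ), ∀ j, mulFun A x j ω = mulFun A y j ω := by
  filter_upwards [h.support, ae_level_congr h.measurable_dom hxy] with ω h1 h2 j
  rw [mulFun_eq_sum h1, mulFun_eq_sum h1]
  exact Finset.sum_congr rfl fun i _ => by rw [h2 i i.2]

theorem measurable_mulFun (h : IsColumnIsometry m m' A) {x : ℕ → PontryaginDual Γ → ℂ}
    (hx : ∀ i, Measurable (x i)) (j : ℕ) : Measurable (mulFun A x j) :=
  Measurable.tsum fun i => (h.measurable j i).mul (hx i)

variable [Countable Γ]

theorem tsum_lintegral_mulFun (h : IsColumnIsometry m m' A) {x : ℕ → PontryaginDual Γ → ℂ}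
    (hx : ∀ i, Measurable (x i)) :
    ∑' j, ∫⁻ ω, ‖mulFun A x j ω‖ₑ ^ 2 ∂((haarDual Γ).restrict (level m' j)) =
      ∑' i, ∫⁻ ω, ‖x i ω‖ₑ ^ 2 ∂((haarDual Γ).restrict (level m i)) := by
  rw [IsRowSystem.tsum_lintegral_indicator (measurableSet_level h.measurable_cod)
      fun j => (h.measurable_mulFun hx j).enorm.pow_const 2,
    IsRowSystem.tsum_lintegral_indicator (measurableSet_level h.measurable_dom)
      fun i => (hx i).enorm.pow_const 2]
  refine lintegral_congr_ae ?_
  filter_upwards [h.support, h.columns] with ω h1 h2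
  rw [tsum_indicator_level, tsum_indicator_level]
  have h3 := sum_norm_sq_of_rows (fun (i : Fin (m ω)) (j : Fin (m' ω)) => A ω j i) 1
    (by simpa using h2) fun i => x i ω
  simp_rw [mulFun_eq_sum h1, enorm_sq_eq]
  rw [← ENNReal.ofReal_sum_of_nonneg (fun _ _ => by positivity),
    ← ENNReal.ofReal_sum_of_nonneg (fun _ _ => by positivity), h3, Nat.cast_one, one_mul]

end IsColumnIsometry

variable [Countable Γ] {m m' : PontryaginDual Γ → ℕ} {A : PontryaginDual Γ → Matrix ℕ ℕ ℂ}

/-- The operator `f ↦ A f` from `⨁ᵢ L²(σᵢ)` to `⨁ⱼ L²(σ'ⱼ)`. -/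
def mulOp (h : IsColumnIsometry m m' A) : CoreV m →ₗᵢ[ℂ] CoreV m' :=
  L2Sum.mkIsometry (fun f => mulFun A fun i => f i)
    (fun f j => (h.measurable_mulFun (IsRowSystem.measurable_coe f) j).aestronglyMeasurable)
    (fun f g j => ae_restrict_of_ae (by
      filter_upwards [h.mulFun_congr fun i => L2Sum.add_ae f g i, h.support] with ω h1 h2
      rw [h1, mulFun_eq_sum h2, mulFun_eq_sum h2, mulFun_eq_sum h2, ← Finset.sum_add_distrib]
      exact Finset.sum_congr rfl fun i _ => mul_add _ _ _))
    (fun a f j => ae_restrict_of_ae (by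
      filter_upwards [h.mulFun_congr fun i => L2Sum.smul_ae a f i] with ω h1
      rw [h1, mulFun, mulFun, ← tsum_mul_left]
      exact tsum_congr fun i => by ring))
    (fun f => by
      rw [h.tsum_lintegral_mulFun (IsRowSystem.measurable_coe f), L2Sum.tsum_lintegral])

theorem mulOp_ae (h : IsColumnIsometry m m' A) (f : CoreV m) (j : ℕ) :
    mulOp h f j =ᵐ[(haarDual Γ).restrict (level m' j)] mulFun A (fun i => f i) j :=
  L2Sum.mkIsometry_ae _ _ _ _ _ f j

theorem mulOp_ae_of_ae (h : IsColumnIsometry m m' A) {f : CoreV m}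
    {x : ℕ → PontryaginDual Γ → ℂ}
    (hx : ∀ i, f i =ᵐ[(haarDual Γ).restrict (level m i)] x i) (j : ℕ) :
    mulOp h f j =ᵐ[(haarDual Γ).restrict (level m' j)] mulFun A x j :=
  (mulOp_ae h f j).trans <| ae_restrict_of_ae <| (h.mulFun_congr hx).mono fun _ h1 => h1 j

theorem mulOp_unitVec_ae (h : IsColumnIsometry m m' A) (i j : ℕ) :
    mulOp h (unitVec m i) j =ᵐ[(haarDual Γ).restrict (level m' j)] fun ω => A ω j i :=
  (mulOp_ae_of_ae h (unitVec_ae m i) j).trans <| Eventually.of_forall fun ω => by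
    simp [mulFun]

theorem mulOp_charRep (h : IsColumnIsometry m m' A) (γ : Γ) (f : CoreV m) :
    mulOp h (charRep _ γ f) = charRep _ γ (mulOp h f) :=
  L2Sum.ext_ae fun j => by
    filter_upwards [mulOp_ae_of_ae h (charRep_ae _ γ f) j, charRep_ae _ γ (mulOp h f) j,
      mulOp_ae h f j] with ω h1 h2 h3
    rw [h1, h2, h3, mulFun, mulFun, ← tsum_mul_left]
    exact tsum_congr fun i => by ring

/-- Operators given by mutually adjoint matrices, both with orthonormal columns, are inverse to
each other. -/
theorem mulOp_mulOp_conjTranspose (h : IsColumnIsometry m m' A)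
    (h' : IsColumnIsometry m' m fun ω => (A ω).conjTranspose) (f : CoreV m') :
    mulOp h (mulOp h' f) = f :=
  L2Sum.ext_ae fun j => by
    refine (mulOp_ae_of_ae h (mulOp_ae h' f) j).trans ?_
    filter_upwards [ae_restrict_of_ae h.support, ae_restrict_of_ae h'.support,
      ae_restrict_of_ae h'.columns, ae_restrict_mem (measurableSet_level h'.measurable_dom j)]
      with ω h1 h2 h3 h4
    rw [mulFun_eq_sum h1]
    have h8 := mulFun_eq_sum (A := fun ω => (A ω).conjTranspose) h2 fun i => f i
    simp_rw [h8, Finset.mul_sum, Matrix.conjTranspose_apply]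
    rw [Finset.sum_comm]
    have h5 := h3 ⟨j, h4⟩
    simp only [Matrix.conjTranspose_apply, RCLike.star_def, Complex.conj_conj] at h5
    have h6 : ∀ k : Fin (m' ω), ∑ i : Fin (m ω), A ω j i * (star (A ω k i) * f k ω) =
        (if (⟨j, h4⟩ : Fin (m' ω)) = k then 1 else 0) * f k ω := fun k => by
      have h7 := congrArg conj (h5 k)
      rw [apply_ite conj, map_one, map_zero] at h7
      rw [← h7, map_sum, Finset.sum_mul]
      refine Finset.sum_congr rfl fun i _ => ?_
      rw [map_mul, Complex.conj_conj, RCLike.star_def]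
      ring
    simp_rw [h6]
    simp

end DilationData

/-- Polarization, for the standard inner product of finite families. -/
theorem sum_mul_conj_eq_of_norm_sq {J : Type*} [Fintype J] (x y : J → ℂ) :
    ∑ j, x j * conj (y j) =
      (((∑ j, ‖x j + y j * 1‖ ^ 2 : ℝ) : ℂ) - ((∑ j, ‖x j + y j * -1‖ ^ 2 : ℝ) : ℂ) +
        (((∑ j, ‖x j + y j * Complex.I‖ ^ 2 : ℝ) : ℂ) -
          ((∑ j, ‖x j + y j * -Complex.I‖ ^ 2 : ℝ) : ℂ)) * Complex.I) / 4 := by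
  rw [eq_div_iff (by norm_num), Finset.sum_mul, Complex.ofReal_sum, Complex.ofReal_sum,
    Complex.ofReal_sum, Complex.ofReal_sum, ← Finset.sum_sub_distrib, ← Finset.sum_sub_distrib,
    Finset.sum_mul, ← Finset.sum_add_distrib]
  refine Finset.sum_congr rfl fun j _ => ?_
  simp only [← Complex.normSq_eq_norm_sq, Complex.normSq_apply]
  apply Complex.ext <;> simp <;> ring

namespace DilationData

variable {Γ : Type u} [CommGroup Γ] [TopologicalSpace Γ] [DiscreteTopology Γ] [Countable Γ]
  {m m' : PontryaginDual Γ → ℕ}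

/-! ### Operators commuting with the characters -/

/-- The vector of `⨁ᵢ L²(σᵢ)` whose only nonzero component is the `i`-th, equal to the restriction
of the given function. -/
def compVec (m : PontryaginDual Γ → ℕ) (i : ℕ) : Lp ℂ 2 (haarDual Γ) →L[ℂ] CoreV m :=
  (lp.singleContinuousLinearMap ℂ (fun i => Lp ℂ 2 ((haarDual Γ).restrict (level m i))) 2 i).comp
    (LpToLpRestrictCLM (PontryaginDual Γ) ℂ ℂ (haarDual Γ) 2 (level m i))

theorem compVec_ae (i : ℕ) (f : Lp ℂ 2 (haarDual Γ)) {φ : PontryaginDual Γ → ℂ}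
    (h : f =ᵐ[haarDual Γ] φ) (k : ℕ) :
    compVec m i f k =ᵐ[(haarDual Γ).restrict (level m k)] fun ω => if k = i then φ ω else 0 :=
  single_ae i _ ((LpToLpRestrictCLM_coeFn ℂ _ f).trans (ae_restrict_of_ae h)) k

theorem compVec_evalChar (i : ℕ) (γ : Γ) :
    compVec m i (ContinuousMap.toLp 2 (haarDual Γ) ℂ (evalChar γ)) =
      charRep _ γ (unitVec m i) :=
  L2Sum.ext_ae fun k => by
    filter_upwards [compVec_ae (m := m) i _
        (ContinuousMap.coeFn_toLp (𝕜 := ℂ) (haarDual Γ) (evalChar γ)) k,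
      charRep_ae _ γ (unitVec m i) k, unitVec_ae m i k] with ω h1 h2 h3
    rw [h1, h2, h3, evalChar_apply]
    split_ifs <;> simp

/-- The matrix of an operator `U`, whose `i`-th column is `U` of the `i`-th `unitVec`. -/
def opMatrix (U : CoreV m →ₗᵢ[ℂ] CoreV m') (ω : PontryaginDual Γ) : Matrix ℕ ℕ ℂ :=
  Matrix.of fun j i => (level m' j).indicator (U (unitVec m i) j) ω

theorem opMatrix_apply (U : CoreV m →ₗᵢ[ℂ] CoreV m') (ω : PontryaginDual Γ) (j i : ℕ) :
    opMatrix U ω j i = (level m' j).indicator (U (unitVec m i) j) ω := rfl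

theorem measurable_opMatrix (hm' : Measurable m') (U : CoreV m →ₗᵢ[ℂ] CoreV m') (j i : ℕ) :
    Measurable fun ω => opMatrix U ω j i :=
  (IsRowSystem.measurable_coe (U (unitVec m i)) j).indicator (measurableSet_level hm' j)

variable {U : CoreV m →ₗᵢ[ℂ] CoreV m'}

/-- An operator commuting with the characters commutes with multiplication by all functions: the
functions for which it does so form a closed subspace of `L²`. -/
theorem apply_compVec_ae (hm' : Measurable m')
    (hU : ∀ (γ : Γ) f, U (charRep _ γ f) = charRep _ γ (U f)) (i j : ℕ)
    (f : Lp ℂ 2 (haarDual Γ)) :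
    U (compVec m i f) j =ᵐ[(haarDual Γ).restrict (level m' j)]
      fun ω => f ω * opMatrix U ω j i := by
  let X : Lp ℂ 2 (haarDual Γ) →L[ℂ] Lp ℂ 2 ((haarDual Γ).restrict (level m' j)) :=
    (lp.evalCLM ℂ (fun j => Lp ℂ 2 ((haarDual Γ).restrict (level m' j))) 2 j).comp
      (U.toContinuousLinearMap.comp (compVec m i))
  have hX : ∀ g, X g = U (compVec m i g) j := fun _ => rfl
  let L : Submodule ℂ (Lp ℂ 2 (haarDual Γ)) :=
    { carrier := {g | X g =ᵐ[(haarDual Γ).restrict (level m' j)]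
        fun ω => g ω * opMatrix U ω j i}
      add_mem' := fun {g g'} (hg : _ =ᵐ[_] _) (hg' : _ =ᵐ[_] _) => by
        change _ =ᵐ[_] _
        rw [map_add]
        filter_upwards [hg, hg', Lp.coeFn_add (X g) (X g'),
          ae_restrict_of_ae (Lp.coeFn_add g g')] with ω h1 h2 h3 h4
        rw [h3, h4, Pi.add_apply, Pi.add_apply, h1, h2, add_mul]
      zero_mem' := by
        change _ =ᵐ[_] _
        rw [map_zero]
        filter_upwards [Lp.coeFn_zero ℂ 2 ((haarDual Γ).restrict (level m' j)),
          ae_restrict_of_ae (Lp.coeFn_zero ℂ 2 (haarDual Γ))] with ω h1 h2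
        rw [h1, h2]
        exact (zero_mul _).symm
      smul_mem' := fun a g (hg : _ =ᵐ[_] _) => by
        change _ =ᵐ[_] _
        rw [map_smul]
        filter_upwards [hg, Lp.coeFn_smul a (X g),
          ae_restrict_of_ae (Lp.coeFn_smul a g)] with ω h1 h2 h3
        rw [h2, h3, Pi.smul_apply, Pi.smul_apply, h1, smul_eq_mul, smul_eq_mul, mul_assoc] }
  have hL : IsClosed (L : Set (Lp ℂ 2 (haarDual Γ))) := by
    refine IsSeqClosed.isClosed fun g g₀ hg hlim => ?_
    obtain ⟨ns, hns, h1⟩ := (tendstoInMeasure_of_tendsto_Lp hlim).exists_seq_tendsto_ae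
    obtain ⟨ks, hks, h2⟩ := (tendstoInMeasure_of_tendsto_Lp
      (((X.continuous.tendsto g₀).comp hlim).comp hns.tendsto_atTop)).exists_seq_tendsto_ae
    change _ =ᵐ[_] _
    have h3 : ∀ᵐ ω ∂((haarDual Γ).restrict (level m' j)), ∀ n,
        X (g n) ω = g n ω * opMatrix U ω j i := ae_all_iff.2 hg
    filter_upwards [ae_restrict_of_ae h1, h2, h3] with ω h1 h2 h3
    refine tendsto_nhds_unique h2 ?_
    simp only [Function.comp_apply, h3]
    exact (h1.comp hks.tendsto_atTop).mul_const _
  have htop := eq_top_of_evalChar_mem (haarDual Γ) L hL fun γ => by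
    change X _ =ᵐ[_] _
    rw [hX, compVec_evalChar, hU]
    filter_upwards [charRep_ae _ γ (U (unitVec m i)) j,
      ae_restrict_of_ae (ContinuousMap.coeFn_toLp (𝕜 := ℂ) (p := 2) (haarDual Γ) (evalChar γ)),
      ae_restrict_mem (measurableSet_level hm' j)] with ω h1 h2 h3
    rw [h1, h2, opMatrix_apply, indicator_of_mem h3, evalChar_apply]
  have hf : f ∈ L := htop ▸ Submodule.mem_top
  exact hf

theorem apply_compVec_indicator_ae (hm' : Measurable m')
    (hU : ∀ (γ : Γ) f, U (charRep _ γ f) = charRep _ γ (U f)) (i j : ℕ)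
    {B : Set (PontryaginDual Γ)} (hB : MeasurableSet B) (z : ℂ) :
    U (compVec m i (indicatorConstLp 2 hB (measure_ne_top (haarDual Γ) B) z)) j
      =ᵐ[(haarDual Γ).restrict (level m' j)]
        B.indicator fun ω => opMatrix U ω j i * z := by
  filter_upwards [apply_compVec_ae hm' hU i j (indicatorConstLp 2 hB (measure_ne_top _ B) z),
    ae_restrict_of_ae (indicatorConstLp_coeFn (p := 2) (hs := hB)
      (hμs := measure_ne_top (haarDual Γ) B) (c := z))] with ω h1 h2
  rw [h1, h2]
  by_cases h : ω ∈ B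
  · rw [indicator_of_mem h, indicator_of_mem h, mul_comm]
  · rw [indicator_of_notMem h, indicator_of_notMem h, zero_mul]

/-- Applying `U` to the function supported off `σᵢ`, which restricts to zero there, shows that the
`i`-th column of its matrix vanishes off `σᵢ`. -/
theorem opMatrix_support (hm : Measurable m) (hm' : Measurable m')
    (hU : ∀ (γ : Γ) f, U (charRep _ γ f) = charRep _ γ (U f)) :
    ∀ᵐ ω ∂(haarDual Γ), ∀ j i, m' ω ≤ j ∨ m ω ≤ i → opMatrix U ω j i = 0 := by
  refine ae_all_iff.2 fun j => ae_all_iff.2 fun i => ?_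
  have hB := (measurableSet_level hm i).compl
  have h0 : compVec m i (indicatorConstLp 2 hB (measure_ne_top (haarDual Γ) _) 1) = 0 :=
    L2Sum.ext_ae fun k => by
      by_cases hk : k = i
      · subst hk
        filter_upwards [compVec_ae (m := m) k _ (indicatorConstLp_coeFn (p := 2) (hs := hB)
          (hμs := measure_ne_top (haarDual Γ) _) (c := (1 : ℂ))) k,
          Lp.coeFn_zero ℂ 2 ((haarDual Γ).restrict (level m k)),
          ae_restrict_mem (measurableSet_level hm k)] with ω h1 h2 h3
        rw [h1, if_pos rfl, indicator_of_notMem (notMem_compl_iff.2 h3)]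
        exact h2.symm
      · filter_upwards [compVec_ae (m := m) i _ (indicatorConstLp_coeFn (p := 2) (hs := hB)
          (hμs := measure_ne_top (haarDual Γ) _) (c := (1 : ℂ))) k,
          Lp.coeFn_zero ℂ 2 ((haarDual Γ).restrict (level m k))] with ω h1 h2
        rw [h1, if_neg hk]
        exact h2.symm
  have h1 := apply_compVec_indicator_ae hm' hU i j hB 1
  rw [h0, map_zero] at h1
  have h2 : ∀ᵐ ω ∂(haarDual Γ).restrict (level m' j),
      (level m i)ᶜ.indicator (fun ω => opMatrix U ω j i * 1) ω = 0 := by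
    filter_upwards [h1, Lp.coeFn_zero ℂ 2 ((haarDual Γ).restrict (level m' j))] with ω h3 h4
    exact h3.symm.trans h4
  rw [ae_restrict_iff' (measurableSet_level hm' j)] at h2
  filter_upwards [h2] with ω h3 h4
  by_cases h5 : ω ∈ level m' j
  · have h6 : ω ∈ (level m i)ᶜ := fun h7 : i < m ω => by
      have : j < m' ω := h5
      omega
    simpa [indicator_of_mem h6] using h3 h5
  · rw [opMatrix_apply, indicator_of_notMem h5]

theorem tsum_lintegral_level (hm : Measurable m) {B : Set (PontryaginDual Γ)}
    (hB : MeasurableSet B) {g : ℕ → PontryaginDual Γ → ℂ} (hg : ∀ j, Measurable (g j)) :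
    ∑' j, ∫⁻ ω, ‖B.indicator (g j) ω‖ₑ ^ 2 ∂((haarDual Γ).restrict (level m j)) =
      ∫⁻ ω in B, ∑' j, (level m j).indicator (fun ω => ‖g j ω‖ₑ ^ 2) ω ∂(haarDual Γ) := by
  rw [IsRowSystem.tsum_lintegral_indicator (measurableSet_level hm)
    fun j => ((hg j).indicator hB).enorm.pow_const 2, ← lintegral_indicator hB]
  refine lintegral_congr fun ω => ?_
  by_cases h : ω ∈ B
  · rw [indicator_of_mem h]
    refine tsum_congr fun j => ?_
    simp only [indicator, h, if_true]
  · rw [indicator_of_notMem h, ENNReal.tsum_eq_zero]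
    intro j
    simp [indicator, h]

/-- Comparing the norms of a vector `χ_B (eᵢ + z eᵢ')` and its image, for all Borel sets `B`. -/
theorem opMatrix_norm_sq (hm : Measurable m) (hm' : Measurable m')
    (hU : ∀ (γ : Γ) f, U (charRep _ γ f) = charRep _ γ (U f)) (z : ℂ) :
    ∀ᵐ ω ∂(haarDual Γ), ∀ i i',
      ∑ j : Fin (m' ω), ‖opMatrix U ω j i + opMatrix U ω j i' * z‖ ^ 2 =
        ∑ k : Fin (m ω), ‖(if (k : ℕ) = i then (1 : ℂ) else 0) +
          (if (k : ℕ) = i' then (1 : ℂ) else 0) * z‖ ^ 2 := by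
  refine ae_all_iff.2 fun i => ae_all_iff.2 fun i' => ?_
  have hg : ∀ j : ℕ, Measurable fun ω => opMatrix U ω j i + opMatrix U ω j i' * z := fun j =>
    (measurable_opMatrix hm' U j i).add ((measurable_opMatrix hm' U j i').mul_const z)
  have hg' : ∀ k : ℕ, Measurable fun _ : PontryaginDual Γ =>
      (if k = i then (1 : ℂ) else 0) + (if k = i' then (1 : ℂ) else 0) * z :=
    fun k => measurable_const
  have hmeas : ∀ {n : PontryaginDual Γ → ℕ} {g : ℕ → PontryaginDual Γ → ℂ}, Measurable n →
      (∀ j, Measurable (g j)) →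
      Measurable fun ω => ∑' j, (level n j).indicator (fun ω => ‖g j ω‖ₑ ^ 2) ω :=
    fun hn hg => Measurable.tsum fun j =>
      ((hg j).enorm.pow_const 2).indicator (measurableSet_level hn j)
  have key := ae_eq_of_forall_setLIntegral_eq_of_sigmaFinite (μ := haarDual Γ)
    (hmeas hm' hg) (hmeas hm hg') fun B hB _ => by
      let e : ℂ → Lp ℂ 2 (haarDual Γ) := indicatorConstLp 2 hB (measure_ne_top (haarDual Γ) B)
      have he : ∀ w, e w =ᵐ[haarDual Γ] B.indicator fun _ => w := fun w => indicatorConstLp_coeFn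
      let v : CoreV m := compVec m i (e 1) + compVec m i' (e z)
      have h1 := L2Sum.tsum_lintegral_congr v (fun k => B.indicator fun _ =>
          (if k = i then (1 : ℂ) else 0) + (if k = i' then (1 : ℂ) else 0) * z) fun k => by
        filter_upwards [L2Sum.add_ae (compVec m i (e 1)) (compVec m i' (e z)) k,
          compVec_ae (m := m) i _ (he 1) k, compVec_ae (m := m) i' _ (he z) k] with ω h1 h2 h3
        rw [h1, h2, h3]
        by_cases h : ω ∈ B <;> simp [h]
      have h2 := L2Sum.tsum_lintegral_congr (U v) (fun j => B.indicator fun ω =>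
          opMatrix U ω j i + opMatrix U ω j i' * z) fun j => by
        rw [map_add]
        filter_upwards [L2Sum.add_ae (U (compVec m i (e 1))) (U (compVec m i' (e z))) j,
          apply_compVec_indicator_ae hm' hU i j hB 1,
          apply_compVec_indicator_ae hm' hU i' j hB z] with ω h1 h2 h3
        rw [h1, h2, h3]
        by_cases h : ω ∈ B <;> simp [h]
      rw [tsum_lintegral_level hm hB hg'] at h1
      rw [tsum_lintegral_level hm' hB hg, U.norm_map, ← h1] at h2
      exact h2
  filter_upwards [key] with ω h
  rw [tsum_indicator_level, tsum_indicator_level] at h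
  simp_rw [enorm_sq_eq] at h
  rwa [← ENNReal.ofReal_sum_of_nonneg (fun _ _ => by positivity),
    ← ENNReal.ofReal_sum_of_nonneg (fun _ _ => by positivity),
    ENNReal.ofReal_eq_ofReal_iff (by positivity) (by positivity)] at h

theorem isColumnIsometry_opMatrix (hm : Measurable m) (hm' : Measurable m')
    (hU : ∀ (γ : Γ) f, U (charRep _ γ f) = charRep _ γ (U f)) :
    IsColumnIsometry m m' (opMatrix U) where
  measurable_dom := hm
  measurable_cod := hm'
  measurable := measurable_opMatrix hm' U
  support := opMatrix_support hm hm' hU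
  columns := by
    filter_upwards [opMatrix_norm_sq hm hm' hU 1, opMatrix_norm_sq hm hm' hU (-1),
      opMatrix_norm_sq hm hm' hU Complex.I, opMatrix_norm_sq hm hm' hU (-Complex.I)]
      with ω h1 h2 h3 h4 i i'
    rw [sum_mul_conj_eq_of_norm_sq, h1, h2, h3, h4, ← sum_mul_conj_eq_of_norm_sq
      (fun k : Fin (m ω) => if (k : ℕ) = i then (1 : ℂ) else 0)
      (fun k => if (k : ℕ) = i' then (1 : ℂ) else 0)]
    simp only [Fin.val_inj, apply_ite conj, map_one, map_zero]
    simp [eq_comm]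

/-- An isometry commuting with the characters is multiplication by its matrix. -/
theorem mulOp_opMatrix (hm : Measurable m) (hm' : Measurable m')
    (hU : ∀ (γ : Γ) f, U (charRep _ γ f) = charRep _ γ (U f)) :
    mulOp (isColumnIsometry_opMatrix hm hm' hU) = U := by
  have h := ext_charRep_unitVec
    (X := (mulOp (isColumnIsometry_opMatrix hm hm' hU)).toContinuousLinearMap)
    (Y := U.toContinuousLinearMap) fun γ i => by
      change mulOp (isColumnIsometry_opMatrix hm hm' hU) (charRep _ γ (unitVec m i)) =
        U (charRep _ γ (unitVec m i))
      rw [mulOp_charRep, hU]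
      congr 1
      refine L2Sum.ext_ae fun j => (mulOp_unitVec_ae _ i j).trans ?_
      filter_upwards [ae_restrict_mem (measurableSet_level hm' j)] with ω h1
      rw [opMatrix_apply, indicator_of_mem h1]
  exact LinearIsometry.ext fun f => DFunLike.congr_fun h f

theorem IsColumnIsometry.ae_le {A : PontryaginDual Γ → Matrix ℕ ℕ ℂ}
    (h : IsColumnIsometry m m' A) : ∀ᵐ ω ∂(haarDual Γ), m ω ≤ m' ω := by
  filter_upwards [h.columns] with ω h1
  let M : Matrix (Fin (m ω)) (Fin (m' ω)) ℂ := Matrix.of fun i j => A ω j i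
  have h2 : M * M.conjTranspose = 1 := by
    ext i i'
    rw [Matrix.mul_apply, Matrix.one_apply, ← h1 i i']
    rfl
  have h3 := Matrix.rank_mul_le_left M M.conjTranspose
  rw [h2, Matrix.rank_one, Fintype.card_fin] at h3
  exact h3.trans M.rank_le_width

end DilationData

/-! ### Equivalence of GMRAs built from Cuntz pairs -/

section abstractEquivalence

variable {V V' : Type u} {W W' : ℕ → Type v}
  [NormedAddCommGroup V] [InnerProductSpace ℂ V] [NormedAddCommGroup V'] [InnerProductSpace ℂ V']
  [∀ n, NormedAddCommGroup (W n)] [∀ n, InnerProductSpace ℂ (W n)]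
  [∀ n, NormedAddCommGroup (W' n)] [∀ n, InnerProductSpace ℂ (W' n)]

theorem GMRA.map_V_of_map_V_zero {Γ : Type w} [CommGroup Γ] {α : Γ →* Γ}
    {ℋ : Type u} [NormedAddCommGroup ℋ] [InnerProductSpace ℂ ℋ] [CompleteSpace ℋ]
    {ℋ' : Type v} [NormedAddCommGroup ℋ'] [InnerProductSpace ℂ ℋ'] [CompleteSpace ℋ']
    (M : GMRA α ℋ) (M' : GMRA α ℋ') (U : ℋ ≃ₗᵢ[ℂ] ℋ') (hδ : ∀ f, U (M.δ f) = M'.δ (U f))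
    (h0 : (M.V 0).map U.toLinearEquiv.toLinearMap = M'.V 0) (j : ℤ) :
    (M.V j).map U.toLinearEquiv.toLinearMap = M'.V j := by
  have hcomp : U.toLinearEquiv.toLinearMap ∘ₗ M.δ.toLinearEquiv.toLinearMap =
      M'.δ.toLinearEquiv.toLinearMap ∘ₗ U.toLinearEquiv.toLinearMap := LinearMap.ext hδ
  have hstep : ∀ j, (M.V (j + 1)).map U.toLinearEquiv.toLinearMap =
      ((M.V j).map U.toLinearEquiv.toLinearMap).map M'.δ.toLinearEquiv.toLinearMap := fun j => by
    rw [M.dilate, ← Submodule.map_comp, hcomp, Submodule.map_comp]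
  induction j using Int.induction_on with
  | zero => exact h0
  | succ n ih => rw [hstep, ih, M'.dilate]
  | pred n ih =>
    have h1 : (-(n : ℤ)) = -(n : ℤ) - 1 + 1 := by ring
    rw [h1, hstep, M'.dilate] at ih
    exact Submodule.map_injective_of_injective M'.δ.injective ih

namespace IsCuntzPair

variable {W₀ W₀' : Type v} [NormedAddCommGroup W₀] [InnerProductSpace ℂ W₀]
  [NormedAddCommGroup W₀'] [InnerProductSpace ℂ W₀']
  {A : V →ₗᵢ[ℂ] V} {B : W₀ →ₗᵢ[ℂ] V} {A' : V' →ₗᵢ[ℂ] V'} {B' : W₀' →ₗᵢ[ℂ] V'}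

/-- A unitary operator that intertwines the first isometries of two Cuntz pairs maps the range of
the second one, which is the orthogonal complement of that of the first, to its counterpart. -/
theorem exists_apply_eq (h : IsCuntzPair A B) (h' : IsCuntzPair A' B') (U : V ≃ₗᵢ[ℂ] V')
    (hU : ∀ v, U (A v) = A' (U v)) (w : W₀) : ∃ w', B' w' = U (B w) := by
  obtain ⟨v', w', h1⟩ := h'.surj (U (B w))
  refine ⟨w', ?_⟩
  -- With `v = U⁻¹ v'`, both `‖w‖² = ‖v‖² + ‖w'‖²` and `‖w'‖² = ‖v‖² + ‖w‖²`, so that `v = 0`.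
  have h2 : U (A (-U.symm v') + B w) = B' w' := by
    rw [map_add, hU, map_neg, LinearIsometryEquiv.apply_symm_apply, ← h1, map_neg,
      neg_add_cancel_left]
  have h3 := h.norm_sq (-U.symm v') w
  rw [← U.norm_map, h2, B'.norm_map, norm_neg, LinearIsometryEquiv.norm_map] at h3
  have h4 := h'.norm_sq v' w'
  rw [h1, U.norm_map, B.norm_map] at h4
  have h5 : ‖v'‖ = 0 := by nlinarith [norm_nonneg v']
  rw [← h1, norm_eq_zero.1 h5, map_zero, zero_add]

/-- The operator between the second spaces induced by such a unitary operator. -/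
theorem exists_unitary (h : IsCuntzPair A B) (h' : IsCuntzPair A' B') (U : V ≃ₗᵢ[ℂ] V')
    (hU : ∀ v, U (A v) = A' (U v)) : ∃ T : W₀ ≃ₗᵢ[ℂ] W₀', ∀ w, B' (T w) = U (B w) := by
  choose F hF using exists_apply_eq h h' U hU
  let T : W₀ →ₗᵢ[ℂ] W₀' :=
    { toFun := F
      map_add' := fun x y => B'.injective (by simp only [hF, map_add])
      map_smul' := fun a x => B'.injective (by simp only [hF, map_smul, RingHom.id_apply])
      norm_map' := fun x => by
        change ‖F x‖ = ‖x‖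
        rw [← B'.norm_map, hF, U.norm_map, B.norm_map] }
  have hU' : ∀ v, U.symm (A' v) = A (U.symm v) := fun v => by
    rw [LinearIsometryEquiv.symm_apply_eq, hU, LinearIsometryEquiv.apply_symm_apply]
  refine ⟨LinearIsometryEquiv.ofSurjective T fun w' => ?_, hF⟩
  obtain ⟨w, hw⟩ := exists_apply_eq h' h U.symm hU' w'
  refine ⟨w, B'.injective ?_⟩
  change B' (F w) = _
  rw [hF, hw, LinearIsometryEquiv.apply_symm_apply]

end IsCuntzPair

/-- The unitary operators `𝒲ₙ → 𝒲'ₙ` obtained from one for `n = 0` by conjugation with the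
operators `D`. -/
def wUnitary (D : ∀ n, W n ≃ₗᵢ[ℂ] W (n + 1)) (D' : ∀ n, W' n ≃ₗᵢ[ℂ] W' (n + 1))
    (T : W 0 ≃ₗᵢ[ℂ] W' 0) : ∀ n, W n ≃ₗᵢ[ℂ] W' n
  | 0 => T
  | n + 1 => (D n).symm.trans ((wUnitary D D' T n).trans (D' n))

/-- The direct sum of unitary operators, on `V ⊕ ⨁ₙ Wₙ`. -/
def coreUnitary (U : V ≃ₗᵢ[ℂ] V') (T : ∀ n, W n ≃ₗᵢ[ℂ] W' n) :
    CoreSum V W ≃ₗᵢ[ℂ] CoreSum V' W' where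
  toFun f := WithLp.toLp 2 (U f.fst, lpMap T f.snd)
  invFun f := WithLp.toLp 2 (U.symm f.fst, (lpMap T).symm f.snd)
  map_add' f g := by refine coreSum_ext ?_ ?_ <;> simp
  map_smul' a f := by refine coreSum_ext ?_ ?_ <;> simp
  left_inv f := by refine coreSum_ext ?_ ?_ <;> simp
  right_inv f := by refine coreSum_ext ?_ ?_ <;> simp
  norm_map' f := by
    rw [← sq_eq_sq₀ (norm_nonneg _) (norm_nonneg _), WithLp.prod_norm_sq_eq_of_L2,
      WithLp.prod_norm_sq_eq_of_L2]
    change ‖U f.fst‖ ^ 2 + ‖lpMap T f.snd‖ ^ 2 = _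
    rw [LinearIsometryEquiv.norm_map, LinearIsometryEquiv.norm_map]

theorem coreUnitary_fst (U : V ≃ₗᵢ[ℂ] V') (T : ∀ n, W n ≃ₗᵢ[ℂ] W' n) (f : CoreSum V W) :
    (coreUnitary U T f).fst = U f.fst := rfl

theorem coreUnitary_snd (U : V ≃ₗᵢ[ℂ] V') (T : ∀ n, W n ≃ₗᵢ[ℂ] W' n) (f : CoreSum V W) (n : ℕ) :
    (coreUnitary U T f).snd n = T n (f.snd n) := rfl

theorem map_coreSubspace_coreUnitary (U : V ≃ₗᵢ[ℂ] V') (T : ∀ n, W n ≃ₗᵢ[ℂ] W' n) :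
    (coreSubspace V W).map (coreUnitary U T).toLinearEquiv.toLinearMap = coreSubspace V' W' := by
  ext f
  rw [mem_coreSubspace]
  constructor
  · rintro ⟨g, hg, rfl⟩
    change lpMap T g.snd = 0
    rw [mem_coreSubspace.1 hg, map_zero]
  · intro hf
    refine ⟨(coreUnitary U T).symm f, ?_, (coreUnitary U T).apply_symm_apply f⟩
    change (lpMap T).symm f.snd = 0
    rw [hf, map_zero]

/-- The vector `(v, 0)` of `V ⊕ ⨁ₙ Wₙ`. -/
def coreIncl (W : ℕ → Type v) [∀ n, NormedAddCommGroup (W n)] [∀ n, InnerProductSpace ℂ (W n)] :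
    V →ₗᵢ[ℂ] CoreSum V W where
  toFun v := WithLp.toLp 2 (v, 0)
  map_add' f g := by refine coreSum_ext ?_ ?_ <;> simp
  map_smul' a f := by refine coreSum_ext ?_ ?_ <;> simp
  norm_map' v := by
    rw [← sq_eq_sq₀ (norm_nonneg _) (norm_nonneg _), WithLp.prod_norm_sq_eq_of_L2]
    simp

theorem coreIncl_fst (v : V) : (coreIncl W v).fst = v := rfl

theorem coreIncl_snd (v : V) : (coreIncl W v).snd = 0 := rfl

theorem coreIncl_mem (v : V) : coreIncl W v ∈ coreSubspace V W := coreIncl_snd v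

theorem coreIncl_of_mem {f : CoreSum V W} (hf : f ∈ coreSubspace V W) : coreIncl W f.fst = f :=
  coreSum_ext rfl hf.symm

variable [CompleteSpace (CoreSum V W)] [CompleteSpace (CoreSum V' W')] {Γ : Type w} [CommGroup Γ]
  {α : Γ →* Γ} {A : V →ₗᵢ[ℂ] V} {B : W 0 →ₗᵢ[ℂ] V} {h : IsCuntzPair A B}
  {D : ∀ n, W n ≃ₗᵢ[ℂ] W (n + 1)} {hA : IsPureIsometry A}
  {ρ : Γ →* (V ≃ₗᵢ[ℂ] V)} {σ : ∀ n, Γ →* (W n ≃ₗᵢ[ℂ] W n)}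
  {hρ : ∀ γ v, A (ρ γ v) = ρ (α γ) (A v)} {hσ : ∀ γ v, B (σ 0 γ v) = ρ (α γ) (B v)}
  {hD : ∀ n γ v, σ (n + 1) γ (D n v) = D n (σ n (α γ) v)}
  {A' : V' →ₗᵢ[ℂ] V'} {B' : W' 0 →ₗᵢ[ℂ] V'} {h' : IsCuntzPair A' B'}
  {D' : ∀ n, W' n ≃ₗᵢ[ℂ] W' (n + 1)} {hA' : IsPureIsometry A'}
  {ρ' : Γ →* (V' ≃ₗᵢ[ℂ] V')} {σ' : ∀ n, Γ →* (W' n ≃ₗᵢ[ℂ] W' n)}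
  {hρ' : ∀ γ v, A' (ρ' γ v) = ρ' (α γ) (A' v)} {hσ' : ∀ γ v, B' (σ' 0 γ v) = ρ' (α γ) (B' v)}
  {hD' : ∀ n γ v, σ' (n + 1) γ (D' n v) = D' n (σ' n (α γ) v)}

theorem coreGMRA_V_zero : (coreGMRA α h D hA ρ σ hρ hσ hD).V 0 = coreSubspace V W := by
  ext f
  change f ∈ (coreSubspace V W).map
    ((invDilation h D) ^ (-(0 : ℤ))).toLinearEquiv.toLinearMap ↔ _
  rw [mem_map_zpow, neg_zero, zpow_zero]
  rfl

/-- The core `V` with the isometry `A` and the representation `ρ` determines the GMRA up to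
equivalence. -/
theorem coreGMRA_equivalent_iff :
    (coreGMRA α h D hA ρ σ hρ hσ hD).Equivalent (coreGMRA α h' D' hA' ρ' σ' hρ' hσ' hD') ↔
      ∃ U : V ≃ₗᵢ[ℂ] V', (∀ γ v, U (ρ γ v) = ρ' γ (U v)) ∧ ∀ v, U (A v) = A' (U v) := by
  constructor
  · rintro ⟨U, hV, hπ, hδ⟩
    have hT : ∀ f, U (invDilation h D f) = invDilation h' D' (U f) := fun f => by
      have h1 : U ((invDilation h D).symm (invDilation h D f)) =
        (invDilation h' D').symm (U (invDilation h D f)) := hδ _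
      rw [LinearIsometryEquiv.symm_apply_apply, LinearIsometryEquiv.eq_symm_apply] at h1
      exact h1.symm
    replace hV := hV 0
    rw [coreGMRA_V_zero, coreGMRA_V_zero] at hV
    have hmem : ∀ v, U (coreIncl W v) ∈ coreSubspace V' W' := fun v =>
      hV ▸ Submodule.mem_map_of_mem (f := U.toLinearEquiv.toLinearMap) (coreIncl_mem v)
    let U₀ : V →ₗᵢ[ℂ] V' :=
      { toFun := fun v => (U (coreIncl W v)).fst
        map_add' := fun x y => by simp
        map_smul' := fun a x => by simp
        norm_map' := fun v => by
          change ‖(U (coreIncl W v)).fst‖ = ‖v‖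
          rw [← (coreIncl W').norm_map, coreIncl_of_mem (hmem v), U.norm_map,
            (coreIncl W).norm_map] }
    have hU₀ : ∀ v, coreIncl W' (U₀ v) = U (coreIncl W v) := fun v => coreIncl_of_mem (hmem v)
    refine ⟨LinearIsometryEquiv.ofSurjective U₀ fun v' => ?_, fun γ v => ?_, fun v => ?_⟩
    · have h1 : coreIncl W' v' ∈ (coreSubspace V W).map U.toLinearEquiv.toLinearMap :=
        hV ▸ coreIncl_mem v'
      obtain ⟨f, hf, h2⟩ := h1
      refine ⟨f.fst, (coreIncl W').injective ?_⟩
      rw [hU₀, coreIncl_of_mem hf]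
      exact h2
    · have h1 : sumRep ρ σ γ (coreIncl W v) = coreIncl W (ρ γ v) :=
        coreSum_ext rfl (map_zero (lpMap fun n => σ n γ))
      have h2 : U (sumRep ρ σ γ (coreIncl W v)) = sumRep ρ' σ' γ (U (coreIncl W v)) := hπ _ _
      rw [h1] at h2
      exact congrArg (fun f : CoreSum V' W' => f.fst) h2
    · have h1 : invDilation h D (coreIncl W v) = coreIncl W (A v) := by
        refine coreSum_ext ?_ ?_
        · rw [invDilation_fst, coreIncl_fst, coreIncl_fst, coreIncl_snd]
          simp
        · ext n
          rw [invDilation_snd, coreIncl_snd, coreIncl_snd]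
          simp
      have h2 : (U (invDilation h D (coreIncl W v))).fst =
        (invDilation h' D' (U (coreIncl W v))).fst := congrArg _ (hT _)
      rw [h1, invDilation_fst, mem_coreSubspace.1 (hmem v)] at h2
      simp only [lp.coeFn_zero, Pi.zero_apply, map_zero, add_zero] at h2
      exact h2
  · rintro ⟨U, hUρ, hUA⟩
    obtain ⟨T, hT⟩ := h.exists_unitary h' U hUA
    have hUT : ∀ f, coreUnitary U (wUnitary D D' T) (invDilation h D f) =
        invDilation h' D' (coreUnitary U (wUnitary D D' T) f) := fun f => by
      refine coreSum_ext ?_ ?_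
      · rw [coreUnitary_fst, invDilation_fst, invDilation_fst, coreUnitary_fst, coreUnitary_snd,
          map_add, hUA]
        exact congrArg _ (hT _).symm
      · ext n
        rw [coreUnitary_snd, invDilation_snd, invDilation_snd, coreUnitary_snd, wUnitary]
        simp
    have hσT : ∀ n γ w, wUnitary D D' T n (σ n γ w) = σ' n γ (wUnitary D D' T n w) := by
      intro n
      induction n with
      | zero =>
        intro γ w
        refine B'.injective ?_
        change B' (T _) = B' (σ' 0 γ (T w))
        rw [hT, hσ, hσ', hT, hUρ]
      | succ n ih =>
        intro γ w
        obtain ⟨w, rfl⟩ := (D n).surjective w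
        rw [hD]
        simp only [wUnitary, LinearIsometryEquiv.trans_apply,
          LinearIsometryEquiv.symm_apply_apply]
        rw [ih, hD']
    have hδ : ∀ f, coreUnitary U (wUnitary D D' T) ((invDilation h D).symm f) =
        (invDilation h' D').symm (coreUnitary U (wUnitary D D' T) f) := fun f => by
      rw [LinearIsometryEquiv.eq_symm_apply, ← hUT, LinearIsometryEquiv.apply_symm_apply]
    refine ⟨coreUnitary U (wUnitary D D' T), GMRA.map_V_of_map_V_zero _ _ _ hδ ?_,
      fun γ f => coreSum_ext (hUρ γ _) ?_, hδ⟩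
    · rw [coreGMRA_V_zero, coreGMRA_V_zero, map_coreSubspace_coreUnitary]
    · ext n
      exact hσT n γ _

end abstractEquivalence

/-! ### Filters and block unitary matrices -/

namespace DilationData

variable {Γ : Type u} [CommGroup Γ] [TopologicalSpace Γ] [DiscreteTopology Γ] [Countable Γ]
  {S : DilationData Γ} {m m' : PontryaginDual Γ → ℕ} {H H' A : PontryaginDual Γ → Matrix ℕ ℕ ℂ}

theorem ruelleH_ae_of_ae (hm : S.IsMultiplicity m) (hH : S.IsFilter m H) {f : CoreV m}
    {x : ℕ → PontryaginDual Γ → ℂ}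
    (hx : ∀ i, f i =ᵐ[(haarDual Γ).restrict (level m i)] x i) (j : ℕ) :
    ruelleH hm hH f j =ᵐ[(haarDual Γ).restrict (level m j)]
      fun ω => ∑' i, H ω i j * x i (S.dual ω) :=
  (ruelle_ae (hH.isRowSystem hm) f j).trans <| ae_restrict_of_ae <|
    ((hH.isRowSystem hm).ruelleFun_congr hx).mono fun _ h => h j

theorem ruelleH_unitVec_ae (hm : S.IsMultiplicity m) (hH : S.IsFilter m H) (i j : ℕ) :
    ruelleH hm hH (unitVec m i) j =ᵐ[(haarDual Γ).restrict (level m j)] fun ω => H ω i j :=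
  (ruelleH_ae_of_ae hm hH (unitVec_ae m i) j).trans <| Eventually.of_forall fun ω => by simp

theorem ruelleH_charRep (hm : S.IsMultiplicity m) (hH : S.IsFilter m H) (γ : Γ) (f : CoreV m) :
    ruelleH hm hH (charRep _ γ f) = charRep _ (S.α γ) (ruelleH hm hH f) :=
  charRep_ruelle (hH.isRowSystem hm) γ f

/-- The matrix identity says that multiplication by `A` intertwines the Ruelle operators on the
vectors `unitVec m i`. -/
theorem mulOp_ruelleH_unitVec_iff (hm : S.IsMultiplicity m) (hH : S.IsFilter m H)
    (hm' : S.IsMultiplicity m') (hH' : S.IsFilter m' H') (hA : IsColumnIsometry m m' A) :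
    (∀ i, mulOp hA (ruelleH hm hH (unitVec m i)) = ruelleH hm' hH' (mulOp hA (unitVec m i))) ↔
      ∀ᵐ ω ∂(haarDual Γ), ∀ i j : ℕ, ∑' l, H ω i l * (A ω).transpose l j =
        ∑' l, (A (S.dual ω)).transpose i l * H' ω l j := by
  have h1 : ∀ i j, mulOp hA (ruelleH hm hH (unitVec m i)) j
      =ᵐ[(haarDual Γ).restrict (level m' j)] fun ω => ∑' l, H ω i l * (A ω).transpose l j :=
    fun i j => (mulOp_ae_of_ae hA (ruelleH_unitVec_ae hm hH i) j).trans <|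
      Eventually.of_forall fun ω => tsum_congr fun l => mul_comm _ _
  have h2 : ∀ i j, ruelleH hm' hH' (mulOp hA (unitVec m i)) j
      =ᵐ[(haarDual Γ).restrict (level m' j)]
        fun ω => ∑' l, (A (S.dual ω)).transpose i l * H' ω l j :=
    fun i j => (ruelleH_ae_of_ae hm' hH' (mulOp_unitVec_ae hA i) j).trans <|
      Eventually.of_forall fun ω => tsum_congr fun l => mul_comm _ _
  constructor
  · intro h
    refine ae_all_iff.2 fun i => ae_all_iff.2 fun j => ?_
    have h3 := (h1 i j).symm.trans ((h i).symm ▸ h2 i j)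
    filter_upwards [(ae_restrict_iff' (measurableSet_level hm'.measurable j)).1 h3, hA.support,
      ae_all_iff.2 fun l => hH'.support l j] with ω h4 h5 h6
    by_cases hj : ω ∈ level m' j
    · exact h4 hj
    -- Off `σ'ⱼ` both sides vanish.
    · simp only [Matrix.transpose_apply, h6 _ hj, h5 j _ (Or.inl (not_lt.1 hj)), mul_zero]
  · intro h i
    refine L2Sum.ext_ae fun j => (h1 i j).trans (EventuallyEq.trans ?_ (h2 i j).symm)
    exact ae_restrict_of_ae (h.mono fun ω hω => hω i j)

theorem mulOp_ruelleH_iff (hm : S.IsMultiplicity m) (hH : S.IsFilter m H)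
    (hm' : S.IsMultiplicity m') (hH' : S.IsFilter m' H') (hA : IsColumnIsometry m m' A) :
    (∀ f, mulOp hA (ruelleH hm hH f) = ruelleH hm' hH' (mulOp hA f)) ↔
      ∀ᵐ ω ∂(haarDual Γ), ∀ i j : ℕ, ∑' l, H ω i l * (A ω).transpose l j =
        ∑' l, (A (S.dual ω)).transpose i l * H' ω l j := by
  rw [← mulOp_ruelleH_unitVec_iff hm hH hm' hH' hA]
  refine ⟨fun h i => h _, fun h f => ?_⟩
  have h1 := ext_charRep_unitVec
    (X := ((mulOp hA).comp (ruelleH hm hH)).toContinuousLinearMap)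
    (Y := ((ruelleH hm' hH').comp (mulOp hA)).toContinuousLinearMap) fun γ i => by
      change mulOp hA (ruelleH hm hH (charRep _ γ (unitVec m i))) =
        ruelleH hm' hH' (mulOp hA (charRep _ γ (unitVec m i)))
      rw [ruelleH_charRep, mulOp_charRep, mulOp_charRep, ruelleH_charRep, h]
  exact DFunLike.congr_fun h1 f

theorem IsBlockUnitary.isColumnIsometry (hA : IsBlockUnitary m A) (hm : Measurable m)
    (hm' : Measurable m') (h : ∀ᵐ ω ∂(haarDual Γ), m ω = m' ω) : IsColumnIsometry m m' A where
  measurable_dom := hm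
  measurable_cod := hm'
  measurable := hA.measurable
  support := h.mono fun ω h1 j i h2 => hA.zero ω j i (h1.symm ▸ h2)
  columns := h.mono fun ω h1 i i' => by
    rw [← h1]
    have h2 := congrFun (congrFun (Matrix.mem_unitaryGroup_iff'.1 (hA.unitary ω)) i') i
    rw [Matrix.mul_apply, Matrix.one_apply] at h2
    simp only [eq_comm (a := i)]
    rw [← h2]
    exact Finset.sum_congr rfl fun j _ => mul_comm _ _

theorem IsBlockUnitary.conjTranspose (hA : IsBlockUnitary m A) :
    IsBlockUnitary m fun ω => (A ω).conjTranspose where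
  measurable i j := Complex.continuous_conj.measurable.comp (hA.measurable j i)
  unitary ω := Unitary.star_mem (hA.unitary ω)
  zero ω i j h := by
    rw [Matrix.conjTranspose_apply, hA.zero ω j i h.symm, star_zero]

/-- A square matrix function with almost everywhere orthonormal columns can be changed on a null
set so as to be block unitary at every point. -/
theorem IsColumnIsometry.exists_isBlockUnitary (h : IsColumnIsometry m m' A)
    (hmm : ∀ᵐ ω ∂(haarDual Γ), m ω = m' ω) :
    ∃ A', IsBlockUnitary m A' ∧ ∀ᵐ ω ∂(haarDual Γ), A' ω = A ω := by
  classical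
  let p : PontryaginDual Γ → Prop := fun ω =>
    (A ω).submatrix (Fin.val : Fin (m ω) → ℕ) (Fin.val : Fin (m ω) → ℕ) ∈
      Matrix.unitaryGroup (Fin (m ω)) ℂ ∧ ∀ i j, m ω ≤ i ∨ m ω ≤ j → A ω i j = 0
  have hp : ∀ᵐ ω ∂(haarDual Γ), p ω := by
    filter_upwards [h.support, h.columns, hmm] with ω h1 h2 h3
    rw [← h3] at h1 h2
    refine ⟨Matrix.mem_unitaryGroup_iff'.2 ?_, h1⟩
    ext i i'
    rw [Matrix.mul_apply, Matrix.one_apply]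
    simp only [eq_comm (a := i)]
    rw [← h2 i' i]
    exact Finset.sum_congr rfl fun j _ => mul_comm _ _
  obtain ⟨Z, hpZ, hZ, hZ0⟩ := exists_measurable_superset_of_null (ae_iff.1 hp)
  let I : PontryaginDual Γ → Matrix ℕ ℕ ℂ := fun ω => Matrix.of fun i j =>
    if i = j then (level m i).indicator 1 ω else 0
  have hI : ∀ i j, Measurable fun ω => I ω i j := fun i j => by
    by_cases hij : i = j
    · simpa [I, hij] using measurable_one.indicator (measurableSet_level h.measurable_dom j)
    · simp [I, hij]
  have hA' : ∀ ω ∉ Z, p ω := fun ω hω => by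
    by_contra hc
    exact hω (hpZ hc)
  refine ⟨Z.piecewise I A, ⟨fun i j => ?_, fun ω => ?_, fun ω i j hij => ?_⟩, ?_⟩
  · have h1 : (fun ω => Z.piecewise I A ω i j) =
        Z.piecewise (fun ω => I ω i j) (fun ω => A ω i j) := by
      ext ω
      by_cases hω : ω ∈ Z <;> simp [hω]
    rw [h1]
    exact (hI i j).piecewise hZ (h.measurable i j)
  · by_cases hω : ω ∈ Z
    · rw [piecewise_eq_of_mem _ _ _ hω]
      convert one_mem (Matrix.unitaryGroup (Fin (m ω)) ℂ)
      ext i j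
      have hi : ω ∈ level m i := i.2
      simp [I, Matrix.one_apply, Fin.val_inj, hi]
    · rw [piecewise_eq_of_notMem _ _ _ hω]
      exact (hA' ω hω).1
  · by_cases hω : ω ∈ Z
    · rw [piecewise_eq_of_mem _ _ _ hω]
      have h1 : i = j → ω ∉ level m i := fun h2 (h3 : i < m ω) => by omega
      by_cases h2 : i = j
      · simp only [I, Matrix.of_apply, if_pos h2, indicator_of_notMem (h1 h2)]
      · simp only [I, Matrix.of_apply, if_neg h2]
    · rw [piecewise_eq_of_notMem _ _ _ hω]
      exact (hA' ω hω).2 i j hij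
  · filter_upwards [measure_eq_zero_iff_ae_notMem.1 hZ0] with ω hω
    exact piecewise_eq_of_notMem _ _ _ hω

/-- Equivalence of canonical GMRAs only concerns the core spaces and the Ruelle operators of the
filters; neither the complementary filters nor the spaces `𝒲ₙ` matter. -/
theorem GMRAParameters.equivalent_iff (P P' : S.GMRAParameters) :
    P.canonicalGMRA.Equivalent P'.canonicalGMRA ↔
      ∃ U : CoreV P.m ≃ₗᵢ[ℂ] CoreV P'.m,
        (∀ (γ : Γ) f, U (charRep _ γ f) = charRep _ γ (U f)) ∧
        ∀ f, U (ruelleH P.isMultiplicity P.isFilter f) =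
          ruelleH P'.isMultiplicity P'.isFilter (U f) :=
  coreGMRA_equivalent_iff

end DilationData

end

theorem mainTheorem3 {Γ : Type*} [CommGroup Γ] [Countable Γ] [TopologicalSpace Γ]
    [DiscreteTopology Γ] (S : DilationData Γ) (P P' : S.GMRAParameters) :
    P.canonicalGMRA.Equivalent P'.canonicalGMRA ↔
      (∀ᵐ ω ∂(haarDual Γ), P.m ω = P'.m ω) ∧
      ∃ A : PontryaginDual Γ → Matrix ℕ ℕ ℂ,
        DilationData.IsBlockUnitary P.m A ∧
        ∀ᵐ ω ∂(haarDual Γ), ∀ i j : ℕ,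
          ∑' l, P.H ω i l * (A ω).transpose l j =
            ∑' l, (A (S.dual ω)).transpose i l * P'.H ω l j := by
  have hm := P.isMultiplicity.measurable
  have hm' := P'.isMultiplicity.measurable
  rw [DilationData.GMRAParameters.equivalent_iff]
  constructor
  · rintro ⟨U, hUπ, hUH⟩
    have hUπ' : ∀ (γ : Γ) f, U.symm (DilationData.charRep _ γ f) =
        DilationData.charRep _ γ (U.symm f) := fun γ f => by
      rw [LinearIsometryEquiv.symm_apply_eq, hUπ, LinearIsometryEquiv.apply_symm_apply]
    have hA := DilationData.isColumnIsometry_opMatrix (U := U.toLinearIsometry) hm hm' hUπ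
    have hA' := DilationData.isColumnIsometry_opMatrix (U := U.symm.toLinearIsometry) hm' hm hUπ'
    have hmm : ∀ᵐ ω ∂(haarDual Γ), P.m ω = P'.m ω := by
      filter_upwards [hA.ae_le, hA'.ae_le] with ω h1 h2
      exact le_antisymm h1 h2
    obtain ⟨A, hAu, hAe⟩ := hA.exists_isBlockUnitary hmm
    refine ⟨hmm, A, hAu, ?_⟩
    have h1 := (DilationData.mulOp_ruelleH_iff P.isMultiplicity P.isFilter P'.isMultiplicity
      P'.isFilter hA).1 (by
        rw [DilationData.mulOp_opMatrix hm hm' hUπ]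
        exact hUH)
    filter_upwards [h1, hAe, S.measurePreserving_dual.quasiMeasurePreserving.ae hAe]
      with ω h2 h3 h4
    rw [h3, h4]
    exact h2
  · rintro ⟨hmm, A, hAu, hAH⟩
    have hA := hAu.isColumnIsometry hm hm' hmm
    have hA' : DilationData.IsColumnIsometry P'.m P.m fun ω => (A ω).conjTranspose := by
      have h1 := hAu.conjTranspose.isColumnIsometry hm hm' hmm
      exact ⟨hm', hm, h1.measurable,
        by filter_upwards [h1.support, hmm] with ω h2 h3; rwa [h3] at h2 ⊢,
        by filter_upwards [h1.columns, hmm] with ω h2 h3; rwa [h3] at h2 ⊢⟩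
    exact ⟨LinearIsometryEquiv.ofSurjective (DilationData.mulOp hA) fun f =>
        ⟨_, DilationData.mulOp_mulOp_conjTranspose hA hA' f⟩,
      DilationData.mulOp_charRep hA,
      (DilationData.mulOp_ruelleH_iff P.isMultiplicity P.isFilter P'.isMultiplicity
        P'.isFilter hA).2 hAH⟩
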